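/- Let $V$ be a complex vector space of finite dimension $n$, and let $d,k\ge 1$ be integers. A subspace $U\subseteq V$ is called isotropic with respect to a symmetric or skew-symmetric $d$-linear form $w$ on $V$ if $w(u_1,\dots,u_d)=0$ for all $u_1,\dots,u_d\in U$. A property holds for a generic form in $S^dV^*$ (resp. in $\Lambda^dV^*$) if it holds for all forms in some nonempty Zariski open subset of that space; here the open subset may depend on $V$, $d$ and $k$. For a generic form $w\in S^dV^*$ (resp. $w\in\Lambda^dV^*$), the space $V$ contains a $k$-dimensional subspace isotropic with respect to $w$ if and only if $$n\ \ge\ \frac{\binom{d+k-1}{d}}{k}+k\qquad\Bigl(\text{resp. } n\ \ge\ \frac{\binom{k}{d}}{k}+k\Bigr),$$ with the following exceptions, in which the necessary and sufficient condition for a generic form $w$ is instead: 1. for $w\in S^2V^*$: $n\ge 2k$; 2. for $w\in\Lambda^2V^*$: $n\ge 2k$ if $n$ is even, and $n\ge 2k-1$ if $n$ is odd; 3. for $w\in\Lambda^{n-2}V^*$ with $n$ even, $n\ge 4$: $k\le n-2$; 4. for $w\in\Lambda^3V^*$ with $n=7$: $k\le 4$. -/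

import Mathlib

/-- The space `S^d V*` of symmetric `d`-linear forms on a complex vector space `V`. (In characteristic
zero these are, by polarization, the same as homogeneous polynomials of degree `d` on `V`.) -/
def SymForm (d : ℕ) (V : Type*) [AddCommGroup V] [Module ℂ V] :
    Submodule ℂ (MultilinearMap ℂ (fun _ : Fin d => V) ℂ) where
  carrier := {f | ∀ (σ : Equiv.Perm (Fin d)) (v : Fin d → V), f (fun i => v (σ i)) = f v}
  add_mem' := by
    intro f g hf hg σ v
    rw [add_apply, add_apply, hf σ v, hg σ v]
  zero_mem' := by
    intro σ v
    rfl
  smul_mem' := by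
    intro c f hf σ v
    rw [smul_apply, smul_apply, hf σ v]

/-- A subspace `U` is isotropic with respect to a `d`-linear form `w` if the restriction of `w`
to `U` is zero. -/
def IsIsotropic {d : ℕ} {V : Type*} [AddCommGroup V] [Module ℂ V]
    (w : MultilinearMap ℂ (fun _ : Fin d => V) ℂ) (U : Submodule ℂ V) : Prop :=
  ∀ v : Fin d → V, (∀ i, v i ∈ U) → w v = 0

/-- `V` contains a `k`-dimensional subspace that is isotropic with respect to `w`. -/
def HasIsotropicSubspace {d : ℕ} {V : Type*} [AddCommGroup V] [Module ℂ V]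
    (w : MultilinearMap ℂ (fun _ : Fin d => V) ℂ) (k : ℕ) : Prop :=
  ∃ U : Submodule ℂ V, Module.finrank ℂ U = k ∧ IsIsotropic w U

/-- A property holds for a generic element of a finite-dimensional complex vector space `W` if it
holds on a nonempty Zariski open subset of `W`; equivalently, since every nonempty Zariski open
subset contains a nonempty principal one, if there is a polynomial function `P` on `W` (a polynomial
expression in linear functionals) that is not identically zero such that the property holds wherever
`P` does not vanish. -/
def HoldsGenerically {W : Type*} [AddCommGroup W] [Module ℂ W] (p : W → Prop) : Prop :=
  ∃ P : MvPolynomial (Module.Dual ℂ W) ℂ,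
    (∃ w₀ : W, MvPolynomial.eval (fun φ : Module.Dual ℂ W => φ w₀) P ≠ 0) ∧
      ∀ w : W, MvPolynomial.eval (fun φ : Module.Dual ℂ W => φ w) P ≠ 0 → p w

/-!
In coordinates a form is an array `t`, and a `k`-dimensional isotropic subspace is the row space of
a `k × n` matrix of rank `k` whose `d`-th tensor power kills `t`.

*Necessity.* After row reduction such a matrix depends on `k (n - k)` parameters, and it satisfies
one relation linear in `t` for each coordinate of the space of forms on a `k`-dimensional space. If
these outnumber the parameters, the relations cannot hold for a form with algebraically independent
coefficients. The exceptional cases need sharper obstructions: the rank of a Gram matrix in degree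
two, the bivector dual to a form of corank two, and the quadric invariant under `G₂` for three-forms
in dimension seven.

*Sufficiency.* By the implicit function theorem, all forms near one vanishing on a fixed `k`-space
have a nearby isotropic subspace, provided that the infinitesimal motions of the `k`-space surject
onto the forms on it. Dually: no nonzero form of degree `d` on the `k`-space may be annihilated by
contraction with `n - k` given forms of degree `d - 1`. Stratify these annihilated forms by the rank
`r` of their flattening, that is, by the number of variables they depend on. A parameter count
excludes each stratum when the `n - k` forms have algebraically independent coefficients; the count
is convex in `r`, so only the extreme ranks matter. Finally, by Chevalley's theorem the forms with
an isotropic `k`-space either avoid a nonempty Zariski open set or contain one, and they form a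
closed set by compactness of the Grassmannian, so an open set of such forms forces all forms to be
such.
-/

section PolynomialMaps

open PrimeSpectrum in
/-- The range is constructible, by Chevalley's theorem, and contains the generic point. -/
theorem exists_basicOpen_subset_range_comap {R S : Type*} [CommRing R] [IsDomain R] [CommRing S]
    {f : R →+* S} (hf : f.FinitePresentation) (hinj : Function.Injective f) :
    ∃ r : R, r ≠ 0 ∧ (basicOpen r : Set (PrimeSpectrum R)) ⊆ Set.range (comap f) := by
  obtain ⟨C, hC⟩ := exists_constructibleSetData_iff.mpr (isConstructible_range_comap hf)
  have generic_mem : (⊥ : PrimeSpectrum R) ∈ C.toSet := by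
    obtain ⟨p, hp, hpf⟩ := Ideal.exists_comap_eq_of_mem_minimalPrimes_of_injective hinj ⊥
      (by simp [IsDomain.minimalPrimes_eq_singleton_bot])
    exact hC ▸ ⟨⟨p, hp⟩, PrimeSpectrum.ext hpf⟩
  simp only [ConstructibleSetData.toSet, Set.mem_iUnion] at generic_mem
  obtain ⟨B, hB, hzero, hf_notMem⟩ := generic_mem
  have hg : ∀ i, B.g i = 0 := fun i => by
    simpa [mem_zeroLocus] using hzero ⟨i, rfl⟩
  refine ⟨B.f, fun h => hf_notMem (by simp [h]), fun p hp => ?_⟩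
  rw [← hC, ConstructibleSetData.toSet]
  refine Set.mem_biUnion hB ⟨?_, ?_⟩
  · rw [mem_zeroLocus]
    rintro _ ⟨i, rfl⟩
    simp [hg i]
  · simpa [mem_zeroLocus] using hp

open MvPolynomial

theorem aeval_finitePresentation {K α β : Type*} [CommRing K] [Finite α] [Finite β]
    (F : β → MvPolynomial α K) :
    (aeval F : MvPolynomial β K →ₐ[K] MvPolynomial α K).toRingHom.FinitePresentation := by
  refine RingHom.FinitePresentation.of_comp_finiteType (algebraMap K (MvPolynomial β K)) ?_ ?_
  · rw [AlgHom.toRingHom_eq_coe, AlgHom.comp_algebraMap, RingHom.finitePresentation_algebraMap]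
    infer_instance
  · rw [RingHom.finiteType_algebraMap]
    infer_instance

variable {K : Type*} [Field K]

theorem exists_eval_eq_of_mem_range_comap [IsAlgClosed K] {α β : Type*} [Finite α]
    {F : β → MvPolynomial α K} {y : β → K} {p : PrimeSpectrum (MvPolynomial β K)}
    (hpy : p.asIdeal = vanishingIdeal K {y})
    (hp : p ∈ Set.range (PrimeSpectrum.comap (aeval F).toRingHom)) :
    ∃ x, ∀ b, eval x (F b) = y b := by
  obtain ⟨q, rfl⟩ := hp
  obtain ⟨M, hM, hqM⟩ := Ideal.exists_le_maximal q.asIdeal q.isPrime.ne_top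
  obtain ⟨x, rfl⟩ := isMaximal_iff_eq_vanishingIdeal_singleton.mp hM
  refine ⟨x, fun b => ?_⟩
  have mem_comap : X b - C (y b) ∈ Ideal.comap (aeval F).toRingHom q.asIdeal := by
    change _ ∈ (PrimeSpectrum.comap (aeval F).toRingHom q).asIdeal
    rw [hpy, mem_vanishingIdeal_singleton_iff]
    simp
  have mem_ideal := hqM (Ideal.mem_comap.mp mem_comap)
  rw [mem_vanishingIdeal_singleton_iff] at mem_ideal
  simpa [sub_eq_zero, coe_aeval_eq_eval] using mem_ideal

theorem eval_eval_eq_eval_aeval {α β : Type*} (F : β → MvPolynomial α K) (x : α → K)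
    (P : MvPolynomial β K) : eval (fun b => eval x (F b)) P = eval x (aeval F P) := by
  induction P using MvPolynomial.induction_on <;> simp_all

theorem polynomial_image_dichotomy [IsAlgClosed K] {α β : Type*} [Finite α] [Finite β]
    (F : β → MvPolynomial α K) :
    (∃ P : MvPolynomial β K, P ≠ 0 ∧ ∀ x, eval (fun b => eval x (F b)) P = 0) ∨
      ∃ P : MvPolynomial β K, P ≠ 0 ∧ ∀ y, eval y P ≠ 0 → ∃ x, ∀ b, eval x (F b) = y b := by
  by_cases hinj : Function.Injective (aeval F : MvPolynomial β K →ₐ[K] MvPolynomial α K)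
  · right
    obtain ⟨P, hP, hsub⟩ := exists_basicOpen_subset_range_comap (aeval_finitePresentation F) hinj
    refine ⟨P, hP, fun y hy => ?_⟩
    have hmax : (vanishingIdeal K {y} : Ideal (MvPolynomial β K)).IsMaximal :=
      isMaximal_iff_eq_vanishingIdeal_singleton.mpr ⟨y, rfl⟩
    refine exists_eval_eq_of_mem_range_comap (p := ⟨_, hmax.isPrime⟩) rfl (hsub ?_)
    change P ∉ vanishingIdeal K {y}
    simpa [mem_vanishingIdeal_singleton_iff, aeval_eq_eval] using hy
  · left
    rw [injective_iff_map_eq_zero] at hinj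
    push Not at hinj
    obtain ⟨P, hP, hP0⟩ := hinj
    exact ⟨P, hP0, fun x => by rw [eval_eval_eq_eval_aeval, hP, map_zero]⟩

end PolynomialMaps

section PolynomialFunctions

/-- The algebra of polynomial functions on a vector space. -/
def polynomialFunction (K W : Type*) [CommRing K] [AddCommGroup W] [Module K W] :
    Subalgebra K (W → K) :=
  Algebra.adjoin K (Set.range fun φ : Module.Dual K W => (φ : W → K))

namespace polynomialFunction

variable {K W W' : Type*} [CommRing K] [AddCommGroup W] [Module K W] [AddCommGroup W'] [Module K W']

theorem dual_mem (φ : Module.Dual K W) : ⇑φ ∈ polynomialFunction K W :=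
  Algebra.subset_adjoin ⟨φ, rfl⟩

theorem const_mem (c : K) : (fun _ => c) ∈ polynomialFunction K W :=
  (polynomialFunction K W).algebraMap_mem c

theorem mem_iff {f : W → K} : f ∈ polynomialFunction K W ↔
    ∃ P : MvPolynomial (Module.Dual K W) K,
      ∀ w, f w = MvPolynomial.eval (fun φ : Module.Dual K W => φ w) P := by
  rw [polynomialFunction, Algebra.adjoin_range_eq_range_aeval, AlgHom.mem_range]
  refine exists_congr fun P => ?_
  rw [eq_comm, funext_iff]
  refine forall_congr' fun w => ?_
  have := MvPolynomial.map_aeval (fun φ : Module.Dual K W => (φ : W → K)) (Pi.evalRingHom _ w) P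
  rw [Pi.evalRingHom_apply] at this
  rw [this]
  rfl

theorem comp_mem {Φ : W → W'} (hΦ : ∀ φ : Module.Dual K W', φ ∘ Φ ∈ polynomialFunction K W)
    {f : W' → K} (hf : f ∈ polynomialFunction K W') : f ∘ Φ ∈ polynomialFunction K W := by
  induction hf using Algebra.adjoin_induction with
  | mem _ h =>
    obtain ⟨φ, rfl⟩ := h
    exact hΦ φ
  | algebraMap c => exact const_mem c
  | add _ _ _ _ hf hg => exact add_mem hf hg
  | mul _ _ _ _ hf hg => exact mul_mem hf hg

open Polynomial in
theorem exists_eval_line {f : W → K} (hf : f ∈ polynomialFunction K W) (w v : W) :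
    ∃ Q : K[X], ∀ t, f (w + t • v) = Q.eval t := by
  induction hf using Algebra.adjoin_induction with
  | mem _ h =>
    obtain ⟨φ, rfl⟩ := h
    exact ⟨C (φ w) + X * C (φ v), fun t => by
      simp only [map_add, map_smul, smul_eq_mul, eval_add, eval_mul, eval_C, eval_X]⟩
  | algebraMap c => exact ⟨C c, fun t => by simp⟩
  | add _ _ _ _ hf hg =>
    obtain ⟨⟨P, hP⟩, Q, hQ⟩ := And.intro hf hg
    exact ⟨P + Q, fun t => by simp [hP, hQ]⟩
  | mul _ _ _ _ hf hg =>
    obtain ⟨⟨P, hP⟩, Q, hQ⟩ := And.intro hf hg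
    exact ⟨P * Q, fun t => by simp [hP, hQ]⟩

variable {ι : Type*}

theorem eval_repr_mem (b : Module.Basis ι K W) (P : MvPolynomial ι K) :
    (fun w => MvPolynomial.eval (b.repr w) P) ∈ polynomialFunction K W := by
  refine mem_iff.mpr ⟨MvPolynomial.rename b.coord P, fun w => ?_⟩
  rw [MvPolynomial.eval_rename]
  rfl

theorem exists_eval_repr [Finite ι] (b : Module.Basis ι K W) {f : W → K}
    (hf : f ∈ polynomialFunction K W) :
    ∃ P : MvPolynomial ι K, ∀ w, f w = MvPolynomial.eval (b.repr w) P := by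
  cases nonempty_fintype ι
  induction hf using Algebra.adjoin_induction with
  | mem _ h =>
    obtain ⟨φ, rfl⟩ := h
    refine ⟨∑ i, MvPolynomial.X i * MvPolynomial.C (φ (b i)), fun w => ?_⟩
    conv_lhs => rw [← b.sum_repr w]
    simp only [map_smul, smul_eq_mul, map_sum, map_mul, MvPolynomial.eval_X, MvPolynomial.eval_C]
  | algebraMap c => exact ⟨MvPolynomial.C c, fun w => by simp⟩
  | add _ _ _ _ hf hg =>
    obtain ⟨⟨P, hP⟩, Q, hQ⟩ := And.intro hf hg
    exact ⟨P + Q, fun w => by simp [hP, hQ]⟩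
  | mul _ _ _ _ hf hg =>
    obtain ⟨⟨P, hP⟩, Q, hQ⟩ := And.intro hf hg
    exact ⟨P * Q, fun w => by simp [hP, hQ]⟩

theorem exists_eval_repr_ne_zero [IsDomain K] [Infinite K] [Finite ι] (b : Module.Basis ι K W)
    {P : MvPolynomial ι K} (hP : P ≠ 0) : ∃ w, MvPolynomial.eval (b.repr w) P ≠ 0 := by
  cases nonempty_fintype ι
  by_contra! h
  refine hP (MvPolynomial.funext fun x => ?_)
  have repr_symm : ⇑(b.repr (b.equivFun.symm x)) = x := b.equivFun.apply_symm_apply x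
  simpa only [repr_symm, map_zero] using h (b.equivFun.symm x)

end polynomialFunction

theorem range_dichotomy {K W W' : Type*} [Field K] [IsAlgClosed K] [AddCommGroup W] [Module K W]
    [AddCommGroup W'] [Module K W'] [FiniteDimensional K W] [FiniteDimensional K W'] (Φ : W → W')
    (hΦ : ∀ φ : Module.Dual K W', φ ∘ Φ ∈ polynomialFunction K W) :
    (∃ f ∈ polynomialFunction K W', (∃ w, f w ≠ 0) ∧ ∀ w, f w ≠ 0 → w ∉ Set.range Φ) ∨
      ∃ f ∈ polynomialFunction K W', (∃ w, f w ≠ 0) ∧ ∀ w, f w ≠ 0 → w ∈ Set.range Φ := by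
  have : Infinite K := IsAlgClosed.instInfinite
  let b := Module.finBasis K W
  let b' := Module.finBasis K W'
  choose F hF using fun i => polynomialFunction.exists_eval_repr b (hΦ (b'.coord i))
  have repr_apply (x : W) : (fun i => MvPolynomial.eval (b.repr x) (F i)) = b'.repr (Φ x) :=
    funext fun i => (hF i x).symm
  rcases polynomial_image_dichotomy F with ⟨P, hP, h⟩ | ⟨P, hP, h⟩
  · refine .inl ⟨_, polynomialFunction.eval_repr_mem b' P,
      polynomialFunction.exists_eval_repr_ne_zero b' hP, ?_⟩
    rintro w hw ⟨x, rfl⟩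
    exact hw (by rw [← repr_apply, h])
  · refine .inr ⟨_, polynomialFunction.eval_repr_mem b' P,
      polynomialFunction.exists_eval_repr_ne_zero b' hP, fun w hw => ?_⟩
    obtain ⟨x, hx⟩ := h _ hw
    refine ⟨b.repr.symm (Finsupp.equivFunOnFinite.symm x), b'.repr.injective ?_⟩
    ext i
    rw [← hx i, ← congrFun (repr_apply _) i]
    simp

end PolynomialFunctions

section HoldsGenerically

variable {W W' : Type*} [AddCommGroup W] [Module ℂ W] [AddCommGroup W'] [Module ℂ W']

theorem holdsGenerically_iff {p : W → Prop} : HoldsGenerically p ↔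
    ∃ f ∈ polynomialFunction ℂ W, (∃ w, f w ≠ 0) ∧ ∀ w, f w ≠ 0 → p w := by
  constructor
  · rintro ⟨P, hP, h⟩
    exact ⟨_, polynomialFunction.mem_iff.mpr ⟨P, fun _ => rfl⟩, hP, h⟩
  · rintro ⟨f, hf, hf0, h⟩
    obtain ⟨P, hP⟩ := polynomialFunction.mem_iff.mp hf
    simp only [hP] at hf0 h
    exact ⟨P, hf0, h⟩

theorem holdsGenerically_of_forall {p : W → Prop} (h : ∀ w, p w) : HoldsGenerically p :=
  ⟨1, ⟨0, by simp⟩, fun w _ => h w⟩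

namespace HoldsGenerically

theorem mono {p q : W → Prop} (h : HoldsGenerically p) (hpq : ∀ w, p w → q w) :
    HoldsGenerically q := by
  obtain ⟨P, hP, h⟩ := h
  exact ⟨P, hP, fun w hw => hpq w (h w hw)⟩

theorem comp_linearEquiv {p : W' → Prop} (h : HoldsGenerically p) (e : W ≃ₗ[ℂ] W') :
    HoldsGenerically fun w => p (e w) := by
  obtain ⟨f, hf, ⟨w, hw⟩, h⟩ := holdsGenerically_iff.mp h
  exact holdsGenerically_iff.mpr ⟨f ∘ e,
    polynomialFunction.comp_mem (fun φ => polynomialFunction.dual_mem (φ ∘ₗ e.toLinearMap)) hf,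
    ⟨e.symm w, by simpa using hw⟩, fun w hw => h _ hw⟩

theorem dense [TopologicalSpace W] [ContinuousAdd W] [ContinuousSMul ℂ W] {p : W → Prop}
    (h : HoldsGenerically p) : Dense {w | p w} := by
  obtain ⟨f, hf, ⟨w₀, hw₀⟩, h⟩ := holdsGenerically_iff.mp h
  intro w
  obtain ⟨Q, hQ⟩ := polynomialFunction.exists_eval_line hf w (w₀ - w)
  have hQ0 : Q ≠ 0 := fun h0 => hw₀ (by simpa [h0] using hQ 1)
  have dense_line : Dense {t : ℂ | f (w + t • (w₀ - w)) ≠ 0} := by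
    have : {t : ℂ | f (w + t • (w₀ - w)) ≠ 0} = (↑Q.roots.toFinset)ᶜ := by
      ext t
      simp [hQ, hQ0]
    rw [this]
    exact (Finset.finite_toSet _).countable.dense_compl ℂ
  have hcont : Continuous fun t : ℂ => w + t • (w₀ - w) := by fun_prop
  have mem_closure := map_mem_closure (t := {w | p w}) hcont (dense_line 0) fun t ht => h _ ht
  simpa using mem_closure

end HoldsGenerically

end HoldsGenerically

/-- The two symmetry types of multilinear forms treated in parallel. -/
inductive FormType
  | symmetric
  | alternating

/-- The character of the symmetric group by which permutations of the arguments act on forms of a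
given type. -/
def FormType.permChar (ε : FormType) {d : ℕ} : Equiv.Perm (Fin d) →* ℤˣ :=
  match ε with
  | symmetric => 1
  | alternating => Equiv.Perm.sign

/-- Coordinate arrays of symmetric or skew-symmetric `d`-linear forms in variables indexed by `ι`:
the entry at `I` is the value of the form at the basis vectors `e (I 0), …, e (I (d - 1))`. -/
def symArray (K : Type*) [CommRing K] (ε : FormType) (d : ℕ) (ι : Type*) :
    Submodule K ((Fin d → ι) → K) where
  carrier := {t | ∀ (σ : Equiv.Perm (Fin d)) (I : Fin d → ι), t (I ∘ σ) = ε.permChar σ • t I}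
  add_mem' hs ht σ I := by rw [Pi.add_apply, hs σ I, ht σ I, ← smul_add, Pi.add_apply]
  zero_mem' σ I := by simp
  smul_mem' c t ht σ I := by rw [Pi.smul_apply, ht σ I, smul_comm, Pi.smul_apply]

section Pull

variable {K : Type*} [CommRing K] {d : ℕ} {ι κ l : Type*}

/-- The `d`-th tensor power of a matrix. -/
def tensorPow (d : ℕ) (A : Matrix κ ι K) : Matrix (Fin d → κ) (Fin d → ι) K :=
  Matrix.of fun J I => ∏ s, A (J s) (I s)

theorem tensorPow_apply (A : Matrix κ ι K) (J : Fin d → κ) (I : Fin d → ι) :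
    tensorPow d A J I = ∏ s, A (J s) (I s) := rfl

theorem tensorPow_apply_eq_zero {A : Matrix κ ι K} {J : Fin d → κ} {I : Fin d → ι} (s : Fin d)
    (h : A (J s) (I s) = 0) : tensorPow d A J I = 0 :=
  Finset.prod_eq_zero (Finset.mem_univ s) h

theorem tensorPow_mul [Fintype κ] (A : Matrix l κ K) (B : Matrix κ ι K) :
    tensorPow d (A * B) = tensorPow d A * tensorPow d B := by
  classical
  ext L I
  simp only [tensorPow_apply, Matrix.mul_apply, Finset.prod_univ_sum, Fintype.piFinset_univ,
    Finset.prod_mul_distrib]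

theorem tensorPow_one [DecidableEq ι] : tensorPow d (1 : Matrix ι ι K) = 1 := by
  ext J I
  rcases eq_or_ne J I with rfl | h
  · simp [tensorPow_apply]
  · obtain ⟨s, hs⟩ := Function.ne_iff.mp h
    rw [tensorPow_apply_eq_zero s (Matrix.one_apply_ne hs), Matrix.one_apply_ne h]

theorem tensorPow_comp_perm (A : Matrix κ ι K) (J : Fin d → κ) (I : Fin d → ι)
    (σ : Equiv.Perm (Fin d)) : tensorPow d A (J ∘ σ) (I ∘ σ) = tensorPow d A J I :=
  Equiv.prod_comp σ fun s => A (J s) (I s)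

theorem sum_comp_perm {M : Type*} [AddCommMonoid M] [Fintype (Fin d → ι)]
    (σ : Equiv.Perm (Fin d)) (f : (Fin d → ι) → M) : ∑ I, f (I ∘ σ) = ∑ I, f I :=
  Equiv.sum_comp (σ.symm.arrowCongr (Equiv.refl ι)) f

variable [Fintype ι]

/-- Restriction of forms in terms of coordinate arrays: the array, in the rows of `A`, of the form
with array `t`. -/
def pull (A : Matrix κ ι K) : ((Fin d → ι) → K) →ₗ[K] ((Fin d → κ) → K) :=
  (tensorPow d A).mulVecLin

theorem pull_apply (A : Matrix κ ι K) (t : (Fin d → ι) → K) (J : Fin d → κ) :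
    pull A t J = ∑ I, tensorPow d A J I * t I := rfl

theorem pull_mul [Fintype κ] (A : Matrix l κ K) (B : Matrix κ ι K) (t : (Fin d → ι) → K) :
    pull (A * B) t = pull A (pull B t) := by
  simp only [pull, Matrix.mulVecLin_apply, tensorPow_mul, Matrix.mulVec_mulVec]

theorem pull_one [DecidableEq ι] (t : (Fin d → ι) → K) : pull 1 t = t := by
  rw [pull, tensorPow_one, Matrix.mulVecLin_one, LinearMap.id_apply]

theorem pull_submatrix (A : Matrix κ ι K) (f : l → κ) (t : (Fin d → ι) → K) (J : Fin d → l) :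
    pull (A.submatrix f id) t J = pull A t (f ∘ J) := rfl

theorem pull_mem_symArray (A : Matrix κ ι K) {ε : FormType} {t : (Fin d → ι) → K}
    (ht : t ∈ symArray K ε d ι) : pull A t ∈ symArray K ε d κ := by
  intro σ J
  calc pull A t (J ∘ σ) = ∑ I, tensorPow d A (J ∘ σ) (I ∘ σ) * t (I ∘ σ) :=
        (sum_comp_perm σ fun I => tensorPow d A (J ∘ σ) I * t I).symm
    _ = ∑ I, ε.permChar σ • (tensorPow d A J I * t I) :=
        Finset.sum_congr rfl fun I _ => by rw [tensorPow_comp_perm, ht σ I, mul_smul_comm]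
    _ = ε.permChar σ • pull A t J := by rw [← Finset.smul_sum, pull_apply]

end Pull

section HasIsotropicRows

variable {K : Type*} [Field K] {d k : ℕ} {ι κ : Type*} [Fintype ι]

/-- The form with coordinate array `t` has an isotropic subspace of dimension `k`, spanned by the
rows of a matrix. -/
def HasIsotropicRows (t : (Fin d → ι) → K) (k : ℕ) : Prop :=
  ∃ A : Matrix (Fin k) ι K, LinearIndependent K A.row ∧ pull A t = 0

theorem pull_eq_zero_of_mem_span [Finite κ] {l : Type*} {A : Matrix κ ι K} {B : Matrix l ι K}
    {t : (Fin d → ι) → K} (h : pull A t = 0)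
    (hB : ∀ i, B i ∈ Submodule.span K (Set.range A.row)) : pull B t = 0 := by
  cases nonempty_fintype κ
  choose C hC using fun i => (Submodule.mem_span_range_iff_exists_fun K).mp (hB i)
  have hBA : B = Matrix.of C * A := by
    ext i j
    simp [← hC i, Matrix.mul_apply, Matrix.row]
  rw [hBA, pull_mul, h, map_zero]

namespace HasIsotropicRows

variable {t : (Fin d → ι) → K}

theorem mono {k' : ℕ} (h : HasIsotropicRows t k) (hk : k' ≤ k) : HasIsotropicRows t k' := by
  obtain ⟨A, hA, h0⟩ := h
  refine ⟨A.submatrix (Fin.castLE hk) id, hA.comp _ (Fin.castLE_injective hk), ?_⟩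
  ext J
  rw [pull_submatrix, h0, Pi.zero_apply, Pi.zero_apply]

theorem le_card (h : HasIsotropicRows t k) : k ≤ Fintype.card ι := by
  obtain ⟨A, hA, -⟩ := h
  simpa using hA.fintype_card_le_finrank

theorem of_submodule (U : Submodule K (ι → K)) (hU : k ≤ Module.finrank K U)
    (h : ∀ A : Matrix (Fin k) ι K, (∀ i, A i ∈ U) → pull A t = 0) : HasIsotropicRows t k := by
  let b := Module.finBasis K U
  exact ⟨Matrix.of fun i => (b (Fin.castLE hU i) : ι → K),
    (b.linearIndependent.comp _ (Fin.castLE_injective hU)).map' U.subtype U.ker_subtype,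
    h _ fun i => (b _).2⟩

theorem exists_submodule (h : HasIsotropicRows t k) :
    ∃ U : Submodule K (ι → K), Module.finrank K U = k ∧
      ∀ {l : Type} (B : Matrix l ι K), (∀ i, B i ∈ U) → pull B t = 0 := by
  obtain ⟨A, hA, h0⟩ := h
  refine ⟨Submodule.span K (Set.range A.row), ?_, fun B hB => pull_eq_zero_of_mem_span h0 hB⟩
  rw [finrank_span_eq_card hA, Fintype.card_fin]

theorem of_comp_equiv [Fintype κ] (e : κ ≃ ι) (h : HasIsotropicRows (fun I => t (e ∘ I)) k) :
    HasIsotropicRows t k := by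
  obtain ⟨A, hA, h0⟩ := h
  refine ⟨A.submatrix id e.symm,
    hA.map' (LinearEquiv.funCongrLeft K K e.symm).toLinearMap (LinearEquiv.ker _), ?_⟩
  ext J
  refine .trans ?_ (congrFun h0 J)
  rw [pull_apply, pull_apply, ← ((Equiv.refl (Fin d)).arrowCongr e).sum_comp]
  refine Finset.sum_congr rfl fun I _ => congrArg₂ (· * ·) ?_ rfl
  change ∏ s, A (J s) (e.symm (e (I s))) = ∏ s, A (J s) (I s)
  simp only [Equiv.symm_apply_apply]

end HasIsotropicRows

end HasIsotropicRows

section Closed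

open Matrix

variable {d k : ℕ} {ι : Type*} [Fintype ι]

theorem linearIndependent_row_of_mul_eq_one {R κ : Type*} [CommRing R] [Finite κ] [DecidableEq κ]
    {A : Matrix κ ι R} {B : Matrix ι κ R} (h : A * B = 1) : LinearIndependent R A.row := by
  cases nonempty_fintype κ
  rw [← vecMul_injective_iff]
  refine Function.LeftInverse.injective (g := fun v => v ᵥ* B) fun v => ?_
  change v ᵥ* A ᵥ* B = v
  rw [vecMul_vecMul, h, vecMul_one]

theorem exists_orthonormal_rows_in_span {A : Matrix (Fin k) ι ℂ} (hA : LinearIndependent ℂ A.row) :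
    ∃ B : Matrix (Fin k) ι ℂ, B * Bᴴ = 1 ∧ ∀ i, B i ∈ Submodule.span ℂ (Set.range A.row) := by
  let e := (WithLp.linearEquiv 2 ℂ (ι → ℂ)).symm
  have hv : LinearIndependent ℂ (e ∘ A.row) := hA.map' e.toLinearMap e.ker
  let u := InnerProductSpace.gramSchmidtNormed ℂ (e ∘ A.row)
  have hu : Orthonormal ℂ u := InnerProductSpace.gramSchmidtNormed_orthonormal hv
  refine ⟨of fun i => e.symm (u i), ?_, fun i => ?_⟩
  · ext i j
    have inner_eq := orthonormal_iff_ite.mp hu j i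
    rw [EuclideanSpace.inner_eq_star_dotProduct] at inner_eq
    rw [one_apply]
    simp only [eq_comm (a := i), ← inner_eq]
    rfl
  · have mem_span : u i ∈ Submodule.span ℂ (Set.range (e ∘ A.row)) := by
      rw [← InnerProductSpace.span_gramSchmidt, ← InnerProductSpace.span_gramSchmidtNormed_range]
      exact Submodule.subset_span ⟨i, rfl⟩
    rw [Set.range_comp, ← LinearEquiv.coe_coe, ← Submodule.map_span] at mem_span
    obtain ⟨x, hx, hxu⟩ := mem_span
    change e.symm (u i) ∈ _
    rwa [← hxu, LinearEquiv.coe_coe, e.symm_apply_apply]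

theorem hasIsotropicRows_iff_orthonormal (t : (Fin d → ι) → ℂ) :
    HasIsotropicRows t k ↔ ∃ A : Matrix (Fin k) ι ℂ, A * Aᴴ = 1 ∧ pull A t = 0 := by
  constructor
  · rintro ⟨A, hA, h⟩
    obtain ⟨B, hB, hBA⟩ := exists_orthonormal_rows_in_span hA
    exact ⟨B, hB, pull_eq_zero_of_mem_span h hBA⟩
  · rintro ⟨A, hA, h⟩
    exact ⟨A, linearIndependent_row_of_mul_eq_one hA, h⟩

theorem norm_apply_le_one_of_mul_conjTranspose_eq_one {A : Matrix (Fin k) ι ℂ} (hA : A * Aᴴ = 1)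
    (i : Fin k) (j : ι) : ‖A i j‖ ≤ 1 := by
  have sum_norm_sq : ∑ l, ‖A i l‖ ^ 2 = 1 := by
    have := congrFun (congrFun hA i) i
    simp only [mul_apply, conjTranspose_apply, one_apply_eq, RCLike.star_def,
      Complex.mul_conj'] at this
    exact_mod_cast this
  rw [← sq_le_one_iff₀ (norm_nonneg _), ← sum_norm_sq]
  exact Finset.single_le_sum (f := fun l => ‖A i l‖ ^ 2) (fun l _ => sq_nonneg _)
    (Finset.mem_univ j)

theorem isCompact_orthonormal_rows (k : ℕ) (ι : Type*) [Fintype ι] :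
    IsCompact {A : Matrix (Fin k) ι ℂ | A * Aᴴ = 1} := by
  have isCompact_pi : IsCompact (Set.pi Set.univ fun _ : Fin k =>
      Set.pi Set.univ fun _ : ι => Metric.closedBall (0 : ℂ) 1) :=
    isCompact_univ_pi fun _ => isCompact_univ_pi fun _ => isCompact_closedBall 0 1
  refine isCompact_pi.of_isClosed_subset ?_ fun A hA i _ j _ => ?_
  · exact isClosed_eq (by fun_prop) continuous_const
  · exact mem_closedBall_zero_iff.mpr (norm_apply_le_one_of_mul_conjTranspose_eq_one hA i j)

theorem isClosed_hasIsotropicRows (k : ℕ) :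
    IsClosed {t : (Fin d → ι) → ℂ | HasIsotropicRows t k} := by
  have : CompactSpace {A : Matrix (Fin k) ι ℂ // A * Aᴴ = 1} :=
    isCompact_iff_compactSpace.mp (isCompact_orthonormal_rows k ι)
  have isClosed_incidence : IsClosed
      {p : {A : Matrix (Fin k) ι ℂ // A * Aᴴ = 1} × ((Fin d → ι) → ℂ) | pull p.1.1 p.2 = 0} := by
    refine isClosed_eq (continuous_pi fun J => ?_) continuous_const
    simp only [pull_apply, tensorPow_apply]
    refine continuous_finsetSum _ fun I _ => Continuous.mul ?_ (by fun_prop)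
    exact continuous_finsetProd _ fun s _ =>
      (continuous_subtype_val.comp continuous_fst).matrix_elem (J s) (I s)
  convert isClosedMap_snd_of_compactSpace _ isClosed_incidence using 1
  ext t
  simp [hasIsotropicRows_iff_orthonormal]

end Closed

section Dichotomy

open Matrix

variable {K : Type*} [Field K]

theorem exists_linearEquiv_apply_eq {V κ : Type*} [AddCommGroup V] [Module K V]
    [Finite κ] {v w : κ → V} (hv : LinearIndependent K v)
    (hw : LinearIndependent K w) : ∃ g : V ≃ₗ[K] V, ∀ i, g (v i) = w i := by
  let bv := Module.Basis.span hv
  let bw := Module.Basis.span hw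
  have : FiniteDimensional K (Submodule.span K (Set.range v)) := .of_basis bv
  obtain ⟨g, hg⟩ := Submodule.exists_linearEquiv_restrict_eq (bv.equiv bw (.refl κ))
  refine ⟨g, fun i => ?_⟩
  have hi := hg (bv i)
  rw [bv.equiv_apply, Equiv.refl_apply, Module.Basis.span_apply, Module.Basis.span_apply] at hi
  exact hi.symm

variable {d k : ℕ} {ι κ : Type*} [Fintype ι]

theorem exists_mul_eq_one_row_eq [DecidableEq ι] (e : κ ↪ ι) {A : Matrix κ ι K}
    (hA : LinearIndependent K A.row) :
    ∃ N M : Matrix ι ι K, N * M = 1 ∧ ∀ i, M (e i) = A i := by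
  have : Finite κ := Finite.of_injective e e.injective
  have hsingle : LinearIndependent K fun i => (Pi.single (e i) 1 : ι → K) :=
    (Pi.linearIndependent_single_one ι K).comp e e.injective
  obtain ⟨g, hg⟩ := exists_linearEquiv_apply_eq hsingle hA
  refine ⟨(LinearMap.toMatrix' g.symm.toLinearMap)ᵀ, (LinearMap.toMatrix' g.toLinearMap)ᵀ, ?_,
    fun i => ?_⟩
  · rw [← transpose_mul, ← LinearMap.toMatrix'_comp, LinearEquiv.comp_symm, LinearMap.toMatrix'_id,
      transpose_one]
  · ext j
    rw [transpose_apply, LinearMap.toMatrix'_apply]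
    exact congrFun (hg i) j

theorem card_notMem_range_add [Fintype κ] (e : κ ↪ ι) [Fintype {i // i ∉ Set.range e}] :
    Fintype.card {i // i ∉ Set.range e} + Fintype.card κ = Fintype.card ι := by
  classical
  rw [Fintype.card_subtype_compl, Set.card_range_of_injective e.injective,
    Nat.sub_add_cancel (Fintype.card_le_of_embedding e)]

theorem hasIsotropicRows_pull (e : Fin k ↪ ι) (g : Matrix ι ι K) {t : (Fin d → ι) → K}
    (ht : ∀ J : Fin d → Fin k, t (e ∘ J) = 0) : HasIsotropicRows (pull g t) k := by
  classical
  let L : (ι → K) →ₗ[K] ({i // i ∉ Set.range e} → K) :=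
    LinearMap.funLeft K K Subtype.val ∘ₗ g.vecMulLinear
  refine .of_submodule (LinearMap.ker L) ?_ fun A hA => ?_
  · have card_compl := card_notMem_range_add e
    have rank_nullity := L.finrank_range_add_finrank_ker
    have range_le := (LinearMap.range L).finrank_le
    rw [Module.finrank_fintype_fun_eq_card] at rank_nullity range_le
    rw [Fintype.card_fin] at card_compl
    omega
  · rw [← pull_mul]
    ext J
    rw [pull_apply]
    refine Finset.sum_eq_zero fun I _ => ?_
    by_cases hI : ∀ s, I s ∈ Set.range e
    · choose J' hJ' using hI
      rw [← funext hJ', show (fun s => e (J' s)) = e ∘ J' from rfl, ht, mul_zero]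
    · push Not at hI
      obtain ⟨s, hs⟩ := hI
      rw [tensorPow_apply_eq_zero s, zero_mul]
      exact congrFun (LinearMap.mem_ker.mp (hA (J s))) ⟨I s, hs⟩

theorem hasIsotropicRows_iff_exists_pull (e : Fin k ↪ ι) {ε : FormType} {t : (Fin d → ι) → K}
    (ht : t ∈ symArray K ε d ι) : HasIsotropicRows t k ↔
      ∃ g : Matrix ι ι K, ∃ t' ∈ symArray K ε d ι,
        (∀ J : Fin d → Fin k, t' (e ∘ J) = 0) ∧ pull g t' = t := by
  classical
  constructor
  · rintro ⟨A, hA, h⟩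
    obtain ⟨N, M, hNM, hM⟩ := exists_mul_eq_one_row_eq e hA
    refine ⟨N, pull M t, pull_mem_symArray M ht, fun J => ?_, by rw [← pull_mul, hNM, pull_one]⟩
    rw [← pull_submatrix, show M.submatrix e id = A from funext hM, h, Pi.zero_apply]
  · rintro ⟨g, t', -, h, rfl⟩
    exact hasIsotropicRows_pull e g h

theorem polynomialFunction.dual_comp_mem {W : Type*} [AddCommGroup W] [Module K W] [Finite κ]
    {S : Submodule K (κ → K)} {Φ : W → S}
    (hΦ : ∀ j, (fun w => (Φ w : κ → K) j) ∈ polynomialFunction K W) (φ : Module.Dual K S) :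
    φ ∘ Φ ∈ polynomialFunction K W := by
  classical
  cases nonempty_fintype κ
  obtain ⟨φ', rfl⟩ := LinearMap.exists_extend φ
  have expand : (φ' ∘ₗ S.subtype) ∘ Φ =
      ∑ j, (fun w => (Φ w : κ → K) j) * fun _ => φ' fun l => if j = l then 1 else 0 := by
    ext w
    simp only [Function.comp_apply, LinearMap.comp_apply, Submodule.subtype_apply,
      LinearMap.pi_apply_eq_sum_univ φ' (Φ w), Finset.sum_apply, Pi.mul_apply, smul_eq_mul]
  exact expand ▸ sum_mem fun j _ => mul_mem (hΦ j) (const_mem _)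

theorem polynomialFunction.pull_mem {T : Submodule K ((Fin d → ι) → K)} (J : Fin d → κ) :
    (fun x : Matrix κ ι K × T => pull x.1 (x.2 : (Fin d → ι) → K) J) ∈
      polynomialFunction K (Matrix κ ι K × T) := by
  have expand : (fun x : Matrix κ ι K × T => pull x.1 (x.2 : (Fin d → ι) → K) J) =
      ∑ I, (∏ s, fun x => x.1 (J s) (I s)) * fun x => (x.2 : (Fin d → ι) → K) I := by
    ext x
    simp only [pull_apply, tensorPow_apply, Finset.sum_apply, Pi.mul_apply, Finset.prod_apply]
  refine expand ▸ sum_mem fun I _ => mul_mem (prod_mem fun s _ => ?_) ?_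
  · exact dual_mem (LinearMap.proj (I s) ∘ₗ LinearMap.proj (J s) ∘ₗ LinearMap.fst K (κ → ι → K) T)
  · exact dual_mem (LinearMap.proj I ∘ₗ T.subtype ∘ₗ LinearMap.snd K (Matrix κ ι K) T)

/-- Forms with isotropic rows are the substitutions of forms vanishing on a fixed coordinate
subspace, hence the image of a polynomial map; they also form a closed set. -/
theorem forall_hasIsotropicRows_or_generically_not (ε : FormType) (k : ℕ) :
    (∀ t : symArray ℂ ε d ι, HasIsotropicRows (t : (Fin d → ι) → ℂ) k) ∨
      HoldsGenerically fun t : symArray ℂ ε d ι => ¬ HasIsotropicRows (t : (Fin d → ι) → ℂ) k := by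
  by_cases hk : k ≤ Fintype.card ι
  swap
  · exact .inr (holdsGenerically_of_forall fun t h => hk h.le_card)
  obtain ⟨e⟩ : Nonempty (Fin k ↪ ι) := Function.Embedding.nonempty_of_card_le (by simpa using hk)
  let T₀ : Submodule ℂ ((Fin d → ι) → ℂ) := symArray ℂ ε d ι ⊓
    LinearMap.ker (LinearMap.funLeft ℂ ℂ fun J : Fin d → Fin k => e ∘ J)
  let Φ : Matrix ι ι ℂ × T₀ → symArray ℂ ε d ι := fun x =>
    ⟨pull x.1 (x.2 : (Fin d → ι) → ℂ), pull_mem_symArray _ x.2.2.1⟩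
  have mem_range (t : symArray ℂ ε d ι) :
      t ∈ Set.range Φ ↔ HasIsotropicRows (t : (Fin d → ι) → ℂ) k := by
    rw [hasIsotropicRows_iff_exists_pull e t.2]
    constructor
    · rintro ⟨⟨g, t, ht, h0⟩, rfl⟩
      exact ⟨g, t, ht, congrFun h0, rfl⟩
    · rintro ⟨g, t', ht', h0, ht⟩
      exact ⟨(g, ⟨t', ht', funext h0⟩), Subtype.ext ht⟩
  simp only [← mem_range]
  refine (range_dichotomy Φ (polynomialFunction.dual_comp_mem fun J =>
    polynomialFunction.pull_mem J)).symm.imp (fun h t => ?_) holdsGenerically_iff.mpr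
  have isClosed_range : IsClosed (Set.range Φ) := by
    convert (isClosed_hasIsotropicRows k).preimage continuous_subtype_val using 1
    exact Set.ext mem_range
  exact isClosed_range.closure_eq ▸ (holdsGenerically_iff.mpr h).dense t

end Dichotomy

section Transcendence

open Matrix

variable {F E α : Type*} [Field F] [Field E] [Algebra F E]

theorem exists_algebraicIndependent_rat (α : Type*) [Finite α] :
    ∃ x : α → ℂ, AlgebraicIndependent ℚ x := by
  obtain ⟨s, hs⟩ := exists_isTranscendenceBasis ℚ ℂ
  have infinite : s.Infinite := fun hfin => by
    have card_le := IsAlgClosed.cardinal_le_max_transcendence_basis _ hs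
    refine absurd ?_ Cardinal.aleph0_lt_continuum.not_ge
    simpa [Cardinal.mk_complex, hfin.lt_aleph0.le] using card_le
  have := infinite.to_subtype
  have := Fintype.ofFinite α
  let f : α ↪ s := (Fintype.equivFin α).toEmbedding.trans
    (Fin.valEmbedding.trans (Infinite.natEmbedding s))
  exact ⟨fun a => f a, hs.1.comp f f.injective⟩

theorem card_le_of_algebraicIndependent_of_mem_adjoin {β : Type*} [Fintype α] [Fintype β]
    {x : α → E} (hx : AlgebraicIndependent F x) (y : β → E)
    (h : ∀ a, x a ∈ IntermediateField.adjoin F (Set.range y)) :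
    Fintype.card α ≤ Fintype.card β := by
  let M := AlgebraicIndependent.matroid F E
  have range_indep : M.Indep (Set.range x) :=
    AlgebraicIndependent.matroid_indep_iff.mpr hx.to_subtype_range
  have range_subset : Set.range x ⊆ M.closure (Set.range y) := by
    rintro _ ⟨a, rfl⟩
    obtain ⟨p, hp, q, hq, hpq⟩ := (IntermediateField.mem_adjoin_iff_div (F := F)).mp (h a)
    rw [AlgebraicIndependent.matroid_closure_eq, hpq, div_eq_mul_inv]
    exact (isAlgebraic_algebraMap (⟨p, hp⟩ : Algebra.adjoin F (Set.range y))).mul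
      (isAlgebraic_algebraMap (⟨q, hq⟩ : Algebra.adjoin F (Set.range y))).inv
  have encard_le : (Set.range x).encard ≤ (Set.range y).encard :=
    (range_indep.encard_le_eRk_of_subset range_subset).trans
      ((M.eRk_closure_eq _).le.trans (M.eRk_le_encard _))
  rw [← Set.image_univ, ← Set.image_univ, hx.injective.encard_image] at encard_le
  simpa [Set.encard_univ] using encard_le.trans (Set.encard_image_le _ _)

theorem exists_left_inverse_of_linearIndependent_col {ρ κ : Type*} [Fintype ρ] [Finite κ]
    [DecidableEq κ] {M : Matrix ρ κ E} (hM : LinearIndependent E M.col) :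
    ∃ Q : Matrix κ ρ E, Q * M = 1 := by
  classical
  cases nonempty_fintype κ
  obtain ⟨g, hg⟩ := (toLin' M).exists_leftInverse_of_injective
    (LinearMap.ker_eq_bot.mpr (mulVec_injective_iff.mpr hM))
  refine ⟨LinearMap.toMatrix' g, ?_⟩
  rw [← LinearMap.toMatrix'_toLin' M, ← LinearMap.toMatrix'_comp, hg, LinearMap.toMatrix'_id]

theorem exists_row_reduction {ρ κ : Type*} [Fintype ρ] [Fintype κ] (M : Matrix ρ κ E) :
    ∃ (Q : Matrix (Fin M.rank) ρ E) (e : Fin M.rank ↪ κ),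
      (Q * M).submatrix id e = 1 ∧ M = M.submatrix id e * (Q * M) := by
  obtain ⟨f, hf, span_eq, linInd⟩ := Submodule.exists_fun_fin_finrank_span_eq E (Set.range M.col)
  rw [M.rank_eq_finrank_span_cols]
  choose e he using hf
  have e_injective : Function.Injective e := fun i j hij => linInd.injective (by
    rw [← he, ← he, hij])
  have linInd_cols : LinearIndependent E (M.submatrix id e).col := by
    rwa [← funext he] at linInd
  obtain ⟨Q, hQ⟩ := exists_left_inverse_of_linearIndependent_col linInd_cols
  have mem_span (j : κ) : M.col j ∈ Submodule.span E (Set.range f) :=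
    span_eq.ge (Submodule.subset_span ⟨j, rfl⟩)
  choose P hP using fun j => (Submodule.mem_span_range_iff_exists_fun E).mp (mem_span j)
  have factorization : M = M.submatrix id e * (of P)ᵀ := by
    ext i j
    have := congrFun (hP j) i
    simp only [← he, Finset.sum_apply, Pi.smul_apply, smul_eq_mul, col_apply] at this
    simp only [mul_apply, submatrix_apply, id, transpose_apply, of_apply, ← this, mul_comm]
  have mul_eq : Q * M = (of P)ᵀ := by
    rw [← Matrix.one_mul (of P)ᵀ, ← hQ, Matrix.mul_assoc, ← factorization]
  exact ⟨Q, ⟨e, e_injective⟩, hQ, by rw [mul_eq]; exact factorization⟩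

theorem mem_of_row_reduced {κ μ l : Type*} [Fintype κ] [DecidableEq l] {R : Matrix l κ E}
    {e : l ↪ κ} {V : Matrix κ μ E} (hR : R.submatrix id e = 1) (hRV : R * V = 0)
    {S : Subfield E} (hRS : ∀ s j, R s j ∈ S) (hVS : ∀ j ∉ Set.range e, ∀ m, V j m ∈ S)
    (j : κ) (m : μ) : V j m ∈ S := by
  classical
  by_cases hj : j ∈ Set.range e
  swap
  · exact hVS j hj m
  obtain ⟨s, rfl⟩ := hj
  have expand : V (e s) m = ∑ j, ((1 : Matrix κ κ E) (e s) j - R s j) * V j m := by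
    simp only [sub_mul, Finset.sum_sub_distrib, ← mul_apply, hRV, Matrix.one_mul,
      Matrix.zero_apply, sub_zero]
  rw [expand]
  refine sum_mem fun j _ => ?_
  by_cases hj : j ∈ Set.range e
  · obtain ⟨s', rfl⟩ := hj
    have hRs : R s (e s') = (1 : Matrix l l E) s s' := congrFun (congrFun hR s) s'
    simp only [hRs, one_apply, e.injective.eq_iff, sub_self, zero_mul, zero_mem]
  · exact mul_mem (sub_mem (by rw [one_apply]; split_ifs <;> simp) (hRS s j)) (hVS j hj m)

/-- Row reduction over the field generated by the entries of `M` expresses `M.rank` of the rows of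
`V` through the remaining ones and these entries. -/
theorem rank_mul_card_le_of_mul_eq_zero {ρ κ μ : Type*} [Finite ρ] [Fintype κ] [Fintype μ]
    [Fintype α] {V : Matrix κ μ E} (hV : AlgebraicIndependent F fun p : κ × μ => V p.1 p.2)
    {M : Matrix ρ κ E} (x : α → E)
    (hM : ∀ i j, M i j ∈ IntermediateField.adjoin F (Set.range x)) (hMV : M * V = 0) :
    M.rank * Fintype.card μ ≤ Fintype.card α := by
  classical
  cases nonempty_fintype ρ
  set L := IntermediateField.adjoin F (Set.range x)
  let M' : Matrix ρ κ L := of fun i j => ⟨M i j, hM i j⟩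
  have hM' : M'.map (algebraMap L E) = M := rfl
  obtain ⟨Q, e, hQe, hM'_eq⟩ := exists_row_reduction M'
  have rank_le : M.rank ≤ M'.rank := by
    rw [← hM', ← Fintype.card_fin M'.rank]
    conv_lhs => rw [hM'_eq, Matrix.map_mul]
    exact (rank_mul_le_left _ _).trans (rank_le_card_width _)
  have relation : (Q * M').map (algebraMap L E) * V = 0 := by
    rw [Matrix.map_mul, Matrix.mul_assoc, hM', hMV, Matrix.mul_zero]
  let y : α ⊕ {j // j ∉ Set.range e} × μ → E := Sum.elim x fun p => V p.1 p.2
  let L' := IntermediateField.adjoin F (Set.range y)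
  have mem_L' (z : L) : (z : E) ∈ L' :=
    IntermediateField.adjoin.mono F _ _ (Set.range_subset_iff.mpr fun a =>
      Set.mem_range_self (f := y) (.inl a)) z.2
  have V_mem (p : κ × μ) : V p.1 p.2 ∈ L' :=
    mem_of_row_reduced (S := L'.toSubfield)
      (by rw [submatrix_map, hQe, Matrix.map_one _ (map_zero _) (map_one _)])
      relation (fun s j => mem_L' _) (fun j hj m =>
        IntermediateField.subset_adjoin F _ (Set.mem_range_self (f := y) (.inr (⟨j, hj⟩, m))))
      p.1 p.2
  have card_le := card_le_of_algebraicIndependent_of_mem_adjoin hV y V_mem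
  rw [Fintype.card_sum, Fintype.card_prod, Fintype.card_prod, ← card_notMem_range_add e,
    Fintype.card_fin, add_mul, add_comm, add_le_add_iff_right] at card_le
  exact (Nat.mul_le_mul_right _ rank_le).trans card_le

end Transcendence

section BasicTuples

variable {ε : FormType} {d : ℕ} {ι : Type*}

/-- Sorted index tuples, strictly sorted in the alternating case: an array of the given type is
determined by its entries at these tuples, which may be prescribed. -/
def FormType.IsBasicTuple [Preorder ι] : FormType → (Fin d → ι) → Prop
  | symmetric, J => Monotone J
  | alternating, J => StrictMono J

/-- The dimension of the space of `d`-linear forms of the given type in `k` variables. -/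
def FormType.formDim : FormType → ℕ → ℕ → ℕ
  | symmetric, d, k => (d + k - 1).choose d
  | alternating, d, k => k.choose d

theorem FormType.IsBasicTuple.monotone [PartialOrder ι] {J : Fin d → ι} (h : ε.IsBasicTuple J) :
    Monotone J := by
  cases ε
  · exact h
  · exact StrictMono.monotone h

theorem FormType.IsBasicTuple.comp_sort [LinearOrder ι] {J : Fin d → ι} (h : ε.IsBasicTuple J) :
    J ∘ Tuple.sort J = J :=
  Tuple.unique_monotone (τ := 1) (Tuple.monotone_sort J) h.monotone

theorem FormType.IsBasicTuple.permChar_eq_one [PartialOrder ι] {J : Fin d → ι}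
    (h : ε.IsBasicTuple J) {σ : Equiv.Perm (Fin d)} (hσ : J ∘ σ = J) : ε.permChar σ = 1 := by
  cases ε
  · rfl
  · rw [show σ = 1 from Equiv.ext fun s => StrictMono.injective h (congrFun hσ s), map_one]

section CommRing

variable {K : Type*} [CommRing K]

theorem apply_eq_permChar_smul {t : (Fin d → ι) → K} (ht : t ∈ symArray K ε d ι)
    (σ : Equiv.Perm (Fin d)) (I : Fin d → ι) : t I = ε.permChar σ • t (I ∘ σ) := by
  rw [ht σ I, smul_smul, Int.units_mul_self, one_smul]

theorem exists_mem_symArray_of_values [LinearOrder ι]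
    (x : {J : Fin d → ι // ε.IsBasicTuple J} → K) :
    ∃ t ∈ symArray K ε d ι, ∀ J, t J.1 = x J := by
  classical
  let t (I : Fin d → ι) : K :=
    if h : ε.IsBasicTuple (I ∘ Tuple.sort I) then ε.permChar (Tuple.sort I) • x ⟨_, h⟩ else 0
  have t_mem : t ∈ symArray K ε d ι := by
    intro σ I
    have sort_eq : (I ∘ σ) ∘ Tuple.sort (I ∘ σ) = I ∘ Tuple.sort I :=
      Tuple.comp_perm_comp_sort_eq_comp_sort
    by_cases h : ε.IsBasicTuple (I ∘ Tuple.sort I)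
    · have stabilizes : (I ∘ Tuple.sort I) ∘ ((Tuple.sort I)⁻¹ * σ * Tuple.sort (I ∘ σ)) =
          I ∘ Tuple.sort I := by
        ext s
        simpa using congrFun sort_eq s
      have char_eq := h.permChar_eq_one stabilizes
      rw [map_mul, map_mul, map_inv, mul_assoc, inv_mul_eq_one] at char_eq
      simp only [t, sort_eq, h, dite_true, char_eq, smul_smul, ← mul_assoc, Int.units_mul_self,
        one_mul]
    · simp only [t, sort_eq, h, dite_false, smul_zero]
  refine ⟨t, t_mem, fun J => ?_⟩
  have h := J.2.comp_sort
  simp only [t, h, J.2, dite_true, J.2.permChar_eq_one h, one_smul]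

end CommRing

variable {K : Type*} [Field K] [CharZero K]

theorem apply_eq_zero_of_not_injective {t : (Fin d → ι) → K}
    (ht : t ∈ symArray K .alternating d ι) {I : Fin d → ι} (hI : ¬ I.Injective) : t I = 0 := by
  classical
  obtain ⟨a, b, hab, hne⟩ := Function.not_injective_iff.mp hI
  have comp_swap : I ∘ Equiv.swap a b = I := by
    rw [Equiv.comp_swap_eq_update, hab, Function.update_eq_self, ← hab, Function.update_eq_self]
  have := ht (Equiv.swap a b) I
  rwa [comp_swap, FormType.permChar, Equiv.Perm.sign_swap hne, Units.neg_smul, one_smul,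
    self_eq_neg] at this

theorem exists_isBasicTuple_comp [LinearOrder ι] {t : (Fin d → ι) → K}
    (ht : t ∈ symArray K ε d ι) {I : Fin d → ι} (hI : t I ≠ 0) :
    ∃ σ : Equiv.Perm (Fin d), ε.IsBasicTuple (I ∘ σ) := by
  refine ⟨Tuple.sort I, ?_⟩
  have monotone := Tuple.monotone_sort I
  cases ε
  · exact monotone
  · have injective : I.Injective := not_not.mp fun h => hI (apply_eq_zero_of_not_injective ht h)
    exact monotone.strictMono_of_injective (injective.comp (Equiv.injective _))

theorem mem_of_forall_isBasicTuple_mem [LinearOrder ι] {t : (Fin d → ι) → K}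
    (ht : t ∈ symArray K ε d ι) {S : Type*} [SetLike S K] [AddSubgroupClass S K] {L : S}
    (h : ∀ J, ε.IsBasicTuple J → t J ∈ L) (I : Fin d → ι) : t I ∈ L := by
  by_cases hI : t I = 0
  · exact hI ▸ zero_mem L
  · obtain ⟨σ, hσ⟩ := exists_isBasicTuple_comp ht hI
    rw [apply_eq_permChar_smul ht σ I, Units.smul_def]
    exact zsmul_mem (h _ hσ) _

noncomputable instance (r : ℕ) : Fintype {J : Fin d → Fin r // ε.IsBasicTuple J} :=
  Fintype.ofFinite _

theorem card_strictMono (d r : ℕ) [Fintype {J : Fin d → Fin r // StrictMono J}] :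
    Fintype.card {J : Fin d → Fin r // StrictMono J} = r.choose d := by
  have card_powerset := Finset.card_powersetCard d (Finset.univ : Finset (Fin r))
  rw [Finset.card_univ, Fintype.card_fin] at card_powerset
  rw [← card_powerset, ← Fintype.card_coe]
  refine Fintype.card_congr (Equiv.ofBijective (fun J => ⟨Finset.univ.map ⟨J.1, J.2.injective⟩,
    by simp [Finset.mem_powersetCard]⟩) ⟨fun J L hJL => ?_, ?_⟩)
  · have range_eq : Set.range J.1 = Set.range L.1 := by
      simpa using congrArg (fun s => (s.1 : Set (Fin r))) hJL
    exact Subtype.ext ((J.2.range_inj L.2).mp range_eq)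
  · rintro ⟨s, hs⟩
    have card_s := (Finset.mem_powersetCard.mp hs).2
    exact ⟨⟨s.orderEmbOfFin card_s, (s.orderEmbOfFin card_s).strictMono⟩,
      Subtype.ext (Finset.coe_injective (by simp))⟩

theorem card_monotone (d r : ℕ) [Fintype {J : Fin d → Fin r // Monotone J}] :
    Fintype.card {J : Fin d → Fin r // Monotone J} = (d + r - 1).choose d := by
  have card_sym := Sym.card_sym_eq_choose (α := Fin r) d
  rw [Fintype.card_fin, Nat.add_comm] at card_sym
  rw [← card_sym]
  refine Fintype.card_congr (Equiv.ofBijective (fun J => ⟨(List.ofFn J.1 : Multiset (Fin r)),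
    by simp⟩) ⟨fun J L hJL => ?_, ?_⟩)
  · have perm := Multiset.coe_eq_coe.mp (congrArg Subtype.val hJL)
    exact Subtype.ext (List.ofFn_injective
      (perm.eq_of_sortedLE J.2.sortedLE_ofFn L.2.sortedLE_ofFn))
  · rintro ⟨s, rfl⟩
    have sorted : (s.sort (· ≤ ·)).SortedLE := (s.pairwise_sort (· ≤ ·)).sortedLE
    have length_eq : (s.sort (· ≤ ·)).length = s.card := s.length_sort _
    refine ⟨⟨fun i => (s.sort (· ≤ ·)).get (i.cast length_eq.symm),
      fun i j hij => sorted.monotone_get hij⟩, Subtype.ext ?_⟩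
    change ((List.ofFn fun i : Fin s.card => (s.sort (· ≤ ·)).get (i.cast length_eq.symm) :
      List (Fin r)) : Multiset (Fin r)) = s
    rw [← List.ofFn_congr length_eq, List.ofFn_get, s.sort_eq]

theorem card_isBasicTuple (ε : FormType) (d r : ℕ) :
    Fintype.card {J : Fin d → Fin r // ε.IsBasicTuple J} = ε.formDim d r := by
  cases ε
  · exact @card_monotone d r (Fintype.ofFinite _)
  · exact @card_strictMono d r (Fintype.ofFinite _)

variable (K) in
theorem finrank_symArray (ε : FormType) (d k : ℕ) :
    Module.finrank K (symArray K ε d (Fin k)) = ε.formDim d k := by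
  let restrict : symArray K ε d (Fin k) →ₗ[K] ({J : Fin d → Fin k // ε.IsBasicTuple J} → K) :=
    LinearMap.funLeft K K Subtype.val ∘ₗ Submodule.subtype _
  have bijective : Function.Bijective restrict := by
    refine ⟨(injective_iff_map_eq_zero _).mpr fun t h => Subtype.ext (funext fun I => ?_),
      fun x => ?_⟩
    · exact mem_of_forall_isBasicTuple_mem (L := (⊥ : AddSubgroup K)) t.2
        (fun J hJ => congrFun h ⟨J, hJ⟩) I
    · obtain ⟨t, ht, htx⟩ := exists_mem_symArray_of_values x
      exact ⟨⟨t, ht⟩, funext htx⟩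
  rw [(LinearEquiv.ofBijective restrict bijective).finrank_eq, Module.finrank_fintype_fun_eq_card,
    card_isBasicTuple]

end BasicTuples

section Symmetrize

variable {K : Type*} {d : ℕ} {ι κ : Type*}

section CommRing

variable [CommRing K]

/-- The sum of the images of an array under all permutations of its indices, with the signs
prescribed by the symmetry type. -/
def symmetrize (ε : FormType) : ((Fin d → ι) → K) →ₗ[K] ((Fin d → ι) → K) :=
  ∑ σ : Equiv.Perm (Fin d), ε.permChar σ • LinearMap.funLeft K K fun I : Fin d → ι => I ∘ σ

theorem symmetrize_apply (ε : FormType) (c : (Fin d → ι) → K) (I : Fin d → ι) :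
    symmetrize ε c I = ∑ σ : Equiv.Perm (Fin d), ε.permChar σ • c (I ∘ σ) := by
  simp only [symmetrize, LinearMap.sum_apply, Finset.sum_apply]
  rfl

theorem symmetrize_mem_symArray (ε : FormType) (c : (Fin d → ι) → K) :
    symmetrize ε c ∈ symArray K ε d ι := by
  intro τ I
  simp only [symmetrize_apply, Finset.smul_sum, smul_smul]
  rw [← Equiv.sum_comp (Equiv.mulLeft τ) fun σ => (ε.permChar τ * ε.permChar σ) • c (I ∘ σ)]
  refine Finset.sum_congr rfl fun σ _ => ?_
  rw [Equiv.coe_mulLeft, map_mul, ← mul_assoc, Int.units_mul_self, one_mul]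
  rfl

theorem symmetrize_eq_factorial_smul {ε : FormType} {t : (Fin d → ι) → K}
    (ht : t ∈ symArray K ε d ι) : symmetrize ε t = (d.factorial : K) • t := by
  ext I
  simp only [symmetrize_apply, ← apply_eq_permChar_smul ht, Finset.sum_const, Finset.card_univ,
    Fintype.card_perm, Fintype.card_fin, nsmul_eq_mul, Pi.smul_apply, smul_eq_mul]

theorem sum_mul_symmetrize [Fintype ι] (ε : FormType) (a b : (Fin d → ι) → K) :
    ∑ I, a I * symmetrize ε b I = ∑ I, symmetrize ε a I * b I := by
  simp only [symmetrize_apply, Finset.mul_sum, Finset.sum_mul]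
  rw [Finset.sum_comm, Finset.sum_comm (s := (Finset.univ : Finset (Fin d → ι))),
    ← Equiv.sum_comp (Equiv.inv (Equiv.Perm (Fin d)))]
  refine Finset.sum_congr rfl fun σ _ => ?_
  rw [← sum_comp_perm σ]
  refine Finset.sum_congr rfl fun I _ => ?_
  have comp_inv : (I ∘ σ) ∘ ⇑σ⁻¹ = I := by
    ext s
    simp
  rw [Equiv.inv_apply, comp_inv, map_inv, Int.units_inv_eq_self, mul_smul_comm, smul_mul_assoc]

theorem pull_symmetrize [Fintype ι] (ε : FormType) (A : Matrix κ ι K) (c : (Fin d → ι) → K) :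
    pull A (symmetrize ε c) = symmetrize ε (pull A c) := by
  ext J
  simp only [pull_apply, symmetrize_apply, Finset.mul_sum, Finset.smul_sum]
  rw [Finset.sum_comm]
  refine Finset.sum_congr rfl fun σ _ => ?_
  rw [← sum_comp_perm σ fun I => ε.permChar σ • (tensorPow d A (J ∘ σ) I * c I)]
  exact Finset.sum_congr rfl fun I _ => by rw [tensorPow_comp_perm, mul_smul_comm]

end CommRing

theorem range_symmetrize [Field K] [CharZero K] (ε : FormType) :
    LinearMap.range (symmetrize (K := K) ε) = symArray K ε d ι := by
  refine le_antisymm ?_ fun t ht => ⟨(d.factorial : K)⁻¹ • t, ?_⟩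
  · rintro _ ⟨c, rfl⟩
    exact symmetrize_mem_symArray ε c
  · rw [map_smul, symmetrize_eq_factorial_smul ht,
      inv_smul_smul₀ (Nat.cast_ne_zero.mpr d.factorial_ne_zero)]

end Symmetrize

section Necessity

open Matrix

variable {K : Type*} {d k : ℕ} {ι κ : Type*}

theorem symmetrize_mem [CommRing K] {S : Type*} [SetLike S K] [AddSubgroupClass S K] {L : S}
    (ε : FormType) {t : (Fin d → ι) → K} (ht : ∀ I, t I ∈ L) (I : Fin d → ι) :
    symmetrize ε t I ∈ L := by
  rw [symmetrize_apply]
  exact sum_mem fun σ _ => by rw [Units.smul_def]; exact zsmul_mem (ht _) _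

theorem apply_mem_of_submatrix_eq_one [CommRing K] {S : Type*} [SetLike S K] [SubringClass S K]
    {L : S} [DecidableEq κ] {A : Matrix κ ι K} {e : κ → ι} (hAe : A.submatrix id e = 1)
    (h : ∀ i, ∀ j ∉ Set.range e, A i j ∈ L) (i : κ) (j : ι) : A i j ∈ L := by
  by_cases hj : j ∈ Set.range e
  · obtain ⟨l, rfl⟩ := hj
    have A_apply : A i (e l) = (1 : Matrix κ κ K) i l := congrFun (congrFun hAe i) l
    rw [A_apply, one_apply]
    split_ifs
    exacts [one_mem L, zero_mem L]
  · exact h i j hj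

variable [Fintype ι]

theorem pull_mem [CommRing K] {S : Type*} [SetLike S K] [SubringClass S K] {L : S}
    {A : Matrix κ ι K} (hA : ∀ i j, A i j ∈ L) {t : (Fin d → ι) → K} (ht : ∀ I, t I ∈ L)
    (J : Fin d → κ) : pull A t J ∈ L := by
  simp only [pull_apply, tensorPow_apply]
  exact sum_mem fun I _ => mul_mem (prod_mem fun s _ => hA (J s) (I s)) (ht I)

theorem map_pull_symArray [CommRing K] [Finite κ] [DecidableEq κ] (ε : FormType)
    {A : Matrix κ ι K} {B : Matrix ι κ K} (hAB : A * B = 1) :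
    (symArray K ε d ι).map (pull A) = symArray K ε d κ := by
  cases nonempty_fintype κ
  refine le_antisymm ?_ fun s hs => ⟨pull B s, pull_mem_symArray B hs, ?_⟩
  · rintro _ ⟨t, ht, rfl⟩
    exact pull_mem_symArray A ht
  · rw [← pull_mul, hAB, pull_one]

theorem HasIsotropicRows.exists_normalized [Field K] {t : (Fin d → ι) → K}
    (h : HasIsotropicRows t k) : ∃ (A : Matrix (Fin k) ι K) (e : Fin k ↪ ι),
      A.submatrix id e = 1 ∧ pull A t = 0 := by
  obtain ⟨A, hA, hAt⟩ := h
  obtain ⟨Q, e, hQe, -⟩ := exists_row_reduction A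
  let c : Fin k ≃ Fin A.rank := finCongr (hA.rank_matrix.trans (Fintype.card_fin k)).symm
  refine ⟨(Q * A).submatrix c id, c.toEmbedding.trans e, ?_, ?_⟩
  · change ((Q * A).submatrix id e).submatrix c c = 1
    rw [hQe, submatrix_one_equiv]
  · ext J
    rw [pull_submatrix, pull_mul, hAt, map_zero, Pi.zero_apply, Pi.zero_apply]

theorem rank_pull_symmetrize [Field K] [CharZero K] [DecidableEq ι] (ε : FormType)
    {A : Matrix (Fin k) ι K} {e : Fin k ↪ ι} (hAe : A.submatrix id e = 1) :
    (LinearMap.toMatrix' (pull A ∘ₗ symmetrize (d := d) ε)).rank = ε.formDim d k := by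
  have hAB : A * (1 : Matrix ι ι K).submatrix id e = 1 :=
    (mul_submatrix_one (.refl ι) e A).trans hAe
  rw [Matrix.rank, ← toLin'_apply', toLin'_toMatrix', LinearMap.range_comp, range_symmetrize,
    map_pull_symArray ε hAB, finrank_symArray]

/-- A form with algebraically independent coefficients satisfies no relation of isotropy: after row
reduction, an isotropic subspace depends on `k * (n - k)` parameters, too few to cut out a
transcendence degree equal to the rank of the relations. -/
theorem exists_not_hasIsotropicRows (ε : FormType)
    (h : k * (Fintype.card ι - k) < ε.formDim d k) :
    ∃ t ∈ symArray ℂ ε d ι, ¬ HasIsotropicRows t k := by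
  classical
  obtain ⟨v, hv⟩ := exists_algebraicIndependent_rat ((Fin d → ι) × Unit)
  refine ⟨symmetrize ε fun I => v (I, ()), symmetrize_mem_symArray ε _, fun hiso => h.not_ge ?_⟩
  obtain ⟨A, e, hAe, hA⟩ := hiso.exists_normalized
  let x : Fin k × {i // i ∉ Set.range e} → ℂ := fun p => A p.1 p.2
  let M := LinearMap.toMatrix' (pull A ∘ₗ symmetrize (d := d) ε)
  let L := IntermediateField.adjoin ℚ (Set.range x)
  have A_mem : ∀ i j, A i j ∈ L := by
    refine apply_mem_of_submatrix_eq_one hAe fun i j hj => ?_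
    exact IntermediateField.subset_adjoin ℚ _ ⟨(i, ⟨j, hj⟩), rfl⟩
  have M_mem (J I) : M J I ∈ L := by
    have M_apply : M J I = pull A (symmetrize ε (Pi.single I 1)) J := LinearMap.toMatrix'_apply ..
    rw [M_apply]
    refine pull_mem A_mem (symmetrize_mem ε fun I' => ?_) J
    rw [Pi.single_apply]
    split_ifs
    exacts [one_mem L, zero_mem L]
  let V : Matrix (Fin d → ι) Unit ℂ := of fun I u => v (I, u)
  have M_mul : M * V = 0 := by
    have mulVec_eq : M *ᵥ (fun I => v (I, ())) = 0 :=
      (LinearMap.toMatrix'_mulVec _ _).trans hA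
    ext J
    exact congrFun mulVec_eq J
  calc ε.formDim d k = M.rank * Fintype.card Unit := by
        rw [rank_pull_symmetrize ε hAe, Fintype.card_unit, mul_one]
    _ ≤ Fintype.card (Fin k × {i // i ∉ Set.range e}) :=
        rank_mul_card_le_of_mul_eq_zero (V := V) hv x M_mem M_mul
    _ = k * (Fintype.card ι - k) := by
        rw [Fintype.card_prod, Fintype.card_fin,
          Nat.eq_sub_of_add_eq (card_notMem_range_add e), Fintype.card_fin]

end Necessity

section Flatten

open Matrix

variable {K : Type*} {d : ℕ} {ι κ : Type*}

/-- The flattening of an array: the matrix whose columns are its slices in the direction of the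
first index. -/
def flatten (g : (Fin (d + 1) → ι) → K) : Matrix ι (Fin d → ι) K :=
  of fun i I => g (Fin.cons i I)

variable [CommRing K] [Fintype ι]

theorem pull_succ (A : Matrix κ ι K) (t : (Fin (d + 1) → ι) → K) (J : Fin (d + 1) → κ) :
    pull A t J = ∑ x, A (J 0) x * pull A (fun I => t (Fin.cons x I)) (Fin.tail J) := by
  rw [pull_apply, ← (Fin.consEquiv fun _ => ι).sum_comp, Fintype.sum_prod_type]
  refine Finset.sum_congr rfl fun x _ => ?_
  rw [pull_apply, Finset.mul_sum]
  refine Finset.sum_congr rfl fun I _ => ?_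
  rw [tensorPow_apply, tensorPow_apply, Fin.prod_univ_succ, mul_assoc]
  rfl

theorem pull_eq_self {Q : Matrix ι ι K} {t : (Fin d → ι) → K}
    (h : ∀ s I, ∑ x, Q (I s) x * t (Function.update I s x) = t I) : pull Q t = t := by
  induction d with
  | zero =>
    ext J
    simp [pull_apply, tensorPow_apply, Subsingleton.elim default J]
  | succ d ih =>
    have pull_slice (x : ι) : pull Q (fun I => t (Fin.cons x I)) = fun I => t (Fin.cons x I) := by
      refine ih fun s I => ?_
      simpa only [Fin.cons_succ, ← Fin.cons_update] using h s.succ (Fin.cons x I)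
    ext J
    induction J using Fin.consCases with | _ i J
    simpa only [pull_succ, pull_slice, Fin.update_cons_zero, Fin.cons_zero, Fin.tail_cons]
      using h 0 (Fin.cons i J)

theorem pull_eq_self_of_mul_flatten {ε : FormType} {Q : Matrix ι ι K}
    {g : (Fin (d + 1) → ι) → K} (hg : g ∈ symArray K ε (d + 1) ι)
    (h : Q * flatten g = flatten g) : pull Q g = g := by
  refine pull_eq_self fun s I => ?_
  let σ := Equiv.swap 0 s
  have update_comp (x : ι) : Function.update I s x ∘ σ = Fin.cons x (Fin.tail (I ∘ σ)) := by
    rw [Function.update_comp_equiv, Equiv.symm_swap, Equiv.swap_apply_right,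
      ← Fin.update_cons_zero ((I ∘ σ) 0), Fin.cons_self_tail]
  have slice := congrFun (congrFun h (I s)) (Fin.tail (I ∘ σ))
  rw [mul_apply] at slice
  calc ∑ x, Q (I s) x * g (Function.update I s x)
      = ε.permChar σ • ∑ x, Q (I s) x * flatten g x (Fin.tail (I ∘ σ)) := by
        rw [Finset.smul_sum]
        refine Finset.sum_congr rfl fun x _ => ?_
        rw [apply_eq_permChar_smul hg σ, update_comp, mul_smul_comm]
        rfl
    _ = g I := by
        have cons_tail : Fin.cons (I s) (Fin.tail (I ∘ σ)) = I ∘ σ := by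
          conv_rhs => rw [← Fin.cons_self_tail (I ∘ σ)]
          rw [Function.comp_apply, Equiv.swap_apply_left]
        rw [slice, apply_eq_permChar_smul hg σ I, flatten, of_apply, cons_tail]

end Flatten

section Separating

open Matrix

variable {K : Type*} [Field K] {ε : FormType} {d : ℕ} {ι : Type*}

theorem exists_pull_eq_of_rank [Fintype ι] {g : (Fin (d + 1) → ι) → K}
    (hg : g ∈ symArray K ε (d + 1) ι) {r : ℕ} (hr : (flatten g).rank = r) :
    ∃ (e : Fin r ↪ ι) (P : Matrix ι (Fin r) K),
      P.submatrix e id = 1 ∧ pull P (fun I => g (e ∘ I)) = g := by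
  classical
  subst hr
  obtain ⟨Q, e, hQe, hQ⟩ := rank_transpose (flatten g) ▸ exists_row_reduction (flatten g)ᵀ
  refine ⟨e, (Q * (flatten g)ᵀ)ᵀ, ?_, ?_⟩
  · rw [← transpose_submatrix, hQe, transpose_one]
  · set P := (Q * (flatten g)ᵀ)ᵀ
    let S : Matrix (Fin (flatten g).rank) ι K := (1 : Matrix ι ι K).submatrix e id
    have pull_S : (fun I => g (e ∘ I)) = pull S g := by
      ext I
      rw [pull_submatrix, pull_one]
    have mul_flatten : P * S * flatten g = flatten g := by
      have S_mul : S * flatten g = (flatten g).submatrix e id :=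
        one_submatrix_mul e (.refl ι) (flatten g)
      rw [Matrix.mul_assoc, S_mul, ← transpose_inj, transpose_mul, transpose_submatrix]
      exact hQ.symm
    rw [pull_S, ← pull_mul]
    exact pull_eq_self_of_mul_flatten hg mul_flatten

theorem exists_adjoin_of_pull_eq {F E : Type*} [Field F] [Field E] [CharZero E] [Algebra F E]
    {r : ℕ} {e : Fin r → ι} {P : Matrix ι (Fin r) E} (hP : P.submatrix e id = 1)
    {H : (Fin (d + 1) → Fin r) → E} (hH : H ∈ symArray E ε (d + 1) (Fin r))
    {J₀ : {J : Fin (d + 1) → Fin r // ε.IsBasicTuple J}} (hJ₀ : H J₀ = 1) :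
    ∃ x : ({i // i ∉ Set.range e} × Fin r) ⊕ {J // J ≠ J₀} → E,
      ∀ I, pull P H I ∈ IntermediateField.adjoin F (Set.range x) := by
  let x := Sum.elim (fun p : {i // i ∉ Set.range e} × Fin r => P p.1 p.2)
    fun J : {J // J ≠ J₀} => H J.1.1
  refine ⟨x, pull_mem (fun i j => ?_) (mem_of_forall_isBasicTuple_mem hH fun J hJ => ?_)⟩
  · have hP' : Pᵀ.submatrix id e = 1 := by rw [← transpose_submatrix, hP, transpose_one]
    refine apply_mem_of_submatrix_eq_one hP' (fun j i hi => ?_) j i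
    exact IntermediateField.subset_adjoin F _ ⟨.inl (⟨i, hi⟩, j), rfl⟩
  · by_cases h : ⟨J, hJ⟩ = J₀
    · rw [show J = J₀ from congrArg Subtype.val h, hJ₀]
      exact one_mem _
    · exact IntermediateField.subset_adjoin F _ ⟨.inr ⟨⟨J, hJ⟩, h⟩, rfl⟩

/-- There are `m` arrays of degree `d` such that no nonzero form of degree `d + 1` is annihilated by
all of them through its flattening. Writing a form near an isotropic subspace of dimension `k` and
codimension `m`, this says that infinitesimal motions of the subspace realize all deformations of
the restricted form. -/
def HasSeparatingArrays (ε : FormType) (d k m : ℕ) : Prop :=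
  ∃ F : Matrix (Fin d → Fin k) (Fin m) ℂ,
    ∀ g ∈ symArray ℂ ε (d + 1) (Fin k), flatten g * F = 0 → g = 0

/-- Forms annihilating algebraically independent arrays, stratified by the rank of their
flattening: a form of rank `r`, up to scale, depends on `r * (k - r)` parameters for its support and
on `formDim (d + 1) r - 1` further ones. -/
theorem rank_flatten_mul_lt {k m r : ℕ} {V : Matrix (Fin d → Fin k) (Fin m) ℂ}
    (hV : AlgebraicIndependent ℚ fun p : (Fin d → Fin k) × Fin m => V p.1 p.2)
    {g : (Fin (d + 1) → Fin k) → ℂ} (hg : g ∈ symArray ℂ ε (d + 1) (Fin k)) (hg0 : g ≠ 0)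
    (hgV : flatten g * V = 0) (hr : (flatten g).rank = r) :
    0 < ε.formDim (d + 1) r ∧ r * m < r * (k - r) + ε.formDim (d + 1) r := by
  classical
  obtain ⟨e, P, hP, hPg⟩ := exists_pull_eq_of_rank hg hr
  let H (I : Fin (d + 1) → Fin r) : ℂ := g (e ∘ I)
  have pull_H : pull P H = g := hPg
  have hH : H ∈ symArray ℂ ε (d + 1) (Fin r) := fun σ I => hg σ (e ∘ I)
  obtain ⟨J, hJ⟩ : ∃ J : {J // ε.IsBasicTuple J}, H J.1 ≠ 0 := by
    by_contra! h
    have H_mem := mem_of_forall_isBasicTuple_mem (L := (⊥ : AddSubgroup ℂ)) hH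
      fun J hJ => h ⟨J, hJ⟩
    have H_eq : H = 0 := funext H_mem
    exact hg0 (by rw [← pull_H, H_eq, map_zero])
  obtain ⟨x, hx⟩ := exists_adjoin_of_pull_eq (F := ℚ) hP (Submodule.smul_mem _ (H J)⁻¹ hH)
    (inv_mul_cancel₀ hJ)
  have M_mem (i I) : ((H J)⁻¹ • flatten g) i I ∈ IntermediateField.adjoin ℚ (Set.range x) := by
    have := hx (Fin.cons i I)
    rwa [map_smul, pull_H] at this
  have M_mul : ((H J)⁻¹ • flatten g) * V = 0 := by rw [Matrix.smul_mul, hgV, smul_zero]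
  have rank_le := rank_mul_card_le_of_mul_eq_zero hV x M_mem M_mul
  have card_ne : Fintype.card {J' // J' ≠ J} = ε.formDim (d + 1) r - 1 :=
    (Set.card_ne_eq J).trans (by rw [card_isBasicTuple])
  have formDim_pos : 0 < ε.formDim (d + 1) r :=
    (Fintype.card_pos_iff.mpr ⟨J⟩).trans_eq (card_isBasicTuple ε (d + 1) r)
  have card_notMem := card_notMem_range_add e
  rw [Fintype.card_fin, Fintype.card_fin] at card_notMem
  rw [rank_smul_of_mem_nonZeroDivisors _ (mem_nonZeroDivisors_of_ne_zero (inv_ne_zero hJ)), hr,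
    Fintype.card_fin, Fintype.card_sum, Fintype.card_prod, Fintype.card_fin,
    Nat.eq_sub_of_add_eq card_notMem, card_ne, Nat.mul_comm (k - r)] at rank_le
  exact ⟨formDim_pos, by lia⟩

theorem hasSeparatingArrays_of_forall_rank {k m : ℕ}
    (h : ∀ r ≤ k, 0 < ε.formDim (d + 1) r → r * (k - r) + ε.formDim (d + 1) r ≤ r * m) :
    HasSeparatingArrays ε d k m := by
  obtain ⟨v, hv⟩ := exists_algebraicIndependent_rat ((Fin d → Fin k) × Fin m)
  let V : Matrix (Fin d → Fin k) (Fin m) ℂ := of fun I a => v (I, a)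
  refine ⟨V, fun g hg hgV => by_contra fun hg0 => ?_⟩
  obtain ⟨formDim_pos, lt⟩ := rank_flatten_mul_lt (V := V) hv hg hg0 hgV rfl
  have rank_le := (rank_le_card_height (flatten g)).trans_eq (Fintype.card_fin k)
  exact lt.not_ge (h _ rank_le formDim_pos)

end Separating

open Topology in
theorem eventually_exists_eq_zero {𝕜 X T S : Type*} [RCLike 𝕜] [NormedAddCommGroup X]
    [NormedSpace 𝕜 X] [CompleteSpace X] [NormedAddCommGroup T] [NormedSpace 𝕜 T] [CompleteSpace T]
    [NormedAddCommGroup S] [NormedSpace 𝕜 S] [CompleteSpace S] {G : X × T → S} {t₀ : T}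
    (hG : ContDiffAt 𝕜 1 G (0, t₀)) {L : X →L[𝕜] S} (hL : Function.Surjective L)
    (h : ∀ x, G (x, t₀) = L x) : ∀ᶠ t in 𝓝 t₀, ∃ x, G (x, t) = 0 := by
  obtain ⟨G', hG'⟩ := hG.differentiableAt one_ne_zero
  have strict : HasStrictFDerivAt G G' (0, t₀) := hG.hasStrictFDerivAt' hG' one_ne_zero
  have partial_eq (x : X) : G' (x, 0) = L x := by
    have partial_G : HasFDerivAt L (G' ∘L ContinuousLinearMap.inl 𝕜 X T) 0 := by
      rw [show ⇑L = fun x => G (x, t₀) from (funext h).symm]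
      exact hG'.comp 0 (hasFDerivAt_prodMk_left 0 t₀)
    exact congrArg (· x) (partial_G.unique L.hasFDerivAt)
  have range_eq_top : LinearMap.range
      (G'.prod (ContinuousLinearMap.snd 𝕜 X T)).toLinearMap = ⊤ := by
    rw [LinearMap.range_eq_top]
    rintro ⟨s, t⟩
    obtain ⟨x, hx⟩ := hL (s - G' (0, t))
    have G'_apply : G' (x, t) = s := by
      rw [← Prod.fst_add_snd (x, t), map_add, partial_eq, hx, sub_add_cancel]
    exact ⟨(x, t), Prod.ext G'_apply rfl⟩
  have range_mem : Set.range (fun p => (G p, p.2)) ∈ 𝓝 ((0 : S), t₀) := by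
    have map_nhds := (strict.prodMk hasStrictFDerivAt_snd).map_nhds_eq_of_surj range_eq_top
    rw [h, map_zero] at map_nhds
    exact map_nhds ▸ Filter.range_mem_map
  filter_upwards [(Continuous.prodMk_right (0 : S)).tendsto t₀ range_mem]
  rintro t ⟨⟨x, t'⟩, hp⟩
  obtain rfl : t' = t := congrArg Prod.snd hp
  exact ⟨x, congrArg Prod.fst hp⟩

section Sufficiency

open Matrix Topology

variable {K : Type*} {d k m : ℕ} {κ μ : Type*} [Fintype κ] [Fintype μ] [DecidableEq κ]

/-- The basis of the graph of a linear map. -/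
def graphRows [CommRing K] (φ : Matrix κ μ K) : Matrix κ (κ ⊕ μ) K :=
  fromCols 1 φ

theorem graphRows_mul_fromRows [CommRing K] (φ : Matrix κ μ K) :
    graphRows φ * (fromRows 1 0 : Matrix (κ ⊕ μ) κ K) = 1 := by
  rw [graphRows, fromCols_mul_fromRows, one_mul, Matrix.mul_zero, add_zero]

/-- The array whose flattening is the product of a linear map with a family of arrays. -/
def contractRows [CommRing K] (F : Matrix (Fin d → κ) μ K) :
    Matrix κ μ K →ₗ[K] ((Fin (d + 1) → κ) → K) where
  toFun φ J := (φ * Fᵀ) (J 0) (Fin.tail J)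
  map_add' φ ψ := by
    ext J
    rw [Matrix.add_mul]
    rfl
  map_smul' c φ := by
    ext J
    rw [Matrix.smul_mul]
    rfl

/-- The form on a direct sum that pairs the first argument, projected to the second summand, with
the forms `F` evaluated at the projections of the other arguments to the first summand. -/
def extendRows [CommRing K] (F : Matrix (Fin d → κ) μ K) : (Fin (d + 1) → κ ⊕ μ) → K :=
  fun L => Sum.elim 0 (fun j => pull (fromRows 1 0) (F.col j) (Fin.tail L)) (L 0)

theorem pull_graphRows_extendRows [CommRing K] (F : Matrix (Fin d → κ) μ K) (φ : Matrix κ μ K) :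
    pull (graphRows φ) (extendRows F) = contractRows F φ := by
  ext J
  have pull_inr (j : μ) :
      pull (graphRows φ) (pull (fromRows 1 0 : Matrix (κ ⊕ μ) κ K) (F.col j)) = F.col j := by
    rw [← pull_mul, graphRows_mul_fromRows, pull_one]
  rw [pull_succ, Fintype.sum_sum_type, Finset.sum_eq_zero, zero_add]
  · refine Finset.sum_congr rfl fun j _ => ?_
    exact congrArg (φ (J 0) j * ·) (congrFun (pull_inr j) (Fin.tail J))
  · intro i _
    exact (congrArg ((1 : Matrix κ κ K) (J 0) i * ·)
      (congrFun (map_zero (pull (graphRows φ))) (Fin.tail J))).trans (mul_zero _)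

theorem sum_mul_contractRows [CommRing K] [DecidableEq μ] (F : Matrix (Fin d → κ) μ K)
    (g : (Fin (d + 1) → κ) → K) (i : κ) (j : μ) :
    ∑ J, g J * contractRows F (Matrix.single i j 1) J = (flatten g * F) i j := by
  rw [← (Fin.consEquiv fun _ => κ).sum_comp, Fintype.sum_prod_type, Fintype.sum_eq_single i]
  · refine Finset.sum_congr rfl fun I _ => ?_
    change g (Fin.cons i I) * (Matrix.single i j (1 : K) * Fᵀ) i I = g (Fin.cons i I) * F I j
    rw [single_mul_apply_same, one_mul, transpose_apply]
  · intro x hx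
    refine Finset.sum_eq_zero fun I _ => ?_
    change g (Fin.cons x I) * (Matrix.single i j (1 : K) * Fᵀ) x I = 0
    rw [single_mul_apply_of_ne (h := hx), mul_zero]

omit [DecidableEq κ] in
theorem exists_symmetrize_contractRows_eq [Field K] [CharZero K] {ε : FormType}
    {F : Matrix (Fin d → κ) μ K}
    (hF : ∀ g ∈ symArray K ε (d + 1) κ, flatten g * F = 0 → g = 0)
    {w : (Fin (d + 1) → κ) → K} (hw : w ∈ symArray K ε (d + 1) κ) :
    ∃ φ, symmetrize ε (contractRows F φ) = w := by
  classical
  change w ∈ LinearMap.range (symmetrize ε ∘ₗ contractRows F)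
  by_contra hwR
  obtain ⟨l, hlw, hl⟩ := Submodule.exists_le_ker_of_notMem hwR
  obtain ⟨G, rfl⟩ := (dotProductEquiv K _).surjective l
  have symmetrize_G : symmetrize ε G = 0 := by
    refine hF _ (symmetrize_mem_symArray ε G) ?_
    ext i j
    rw [← sum_mul_contractRows, ← sum_mul_symmetrize]
    exact hl ⟨Matrix.single i j 1, rfl⟩
  have dotProduct_symmetrize : ((d + 1).factorial : K) • (G ⬝ᵥ w) = 0 := by
    calc ((d + 1).factorial : K) • (G ⬝ᵥ w) = G ⬝ᵥ symmetrize ε w := by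
          rw [symmetrize_eq_factorial_smul hw, dotProduct_smul]
      _ = symmetrize ε G ⬝ᵥ w := sum_mul_symmetrize ε G w
      _ = 0 := by rw [symmetrize_G, zero_dotProduct]
  exact hlw ((smul_eq_zero_iff_right (Nat.cast_ne_zero.mpr (Nat.factorial_ne_zero _))).mp
    dotProduct_symmetrize)

section Smooth

attribute [local instance] Matrix.normedAddCommGroup Matrix.normedSpace

theorem contDiff_pull_graphRows {n : WithTop ℕ∞} :
    ContDiff ℂ n fun p : Matrix κ μ ℂ × ((Fin d → κ ⊕ μ) → ℂ) => pull (graphRows p.1) p.2 := by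
  have contDiff_entry (i : κ) (j : κ ⊕ μ) :
      ContDiff ℂ n fun p : Matrix κ μ ℂ × ((Fin d → κ ⊕ μ) → ℂ) => graphRows p.1 i j := by
    rcases j with j | j
    · exact contDiff_const
    · exact (contDiff_apply_apply ℂ ℂ i j).comp contDiff_fst
  refine contDiff_pi.mpr fun J => ?_
  simp only [pull_apply, tensorPow_apply]
  exact ContDiff.sum fun I _ => (contDiff_prod fun s _ => contDiff_entry (J s) (I s)).mul
    ((contDiff_apply ℂ ℂ I).comp contDiff_snd)

theorem eventually_exists_pull_graphRows_eq_zero {ε : FormType} {F : Matrix (Fin d → κ) μ ℂ}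
    (hF : ∀ g ∈ symArray ℂ ε (d + 1) κ, flatten g * F = 0 → g = 0) :
    ∀ᶠ t in 𝓝 (symmetrize ε (extendRows F)), t ∈ symArray ℂ ε (d + 1) (κ ⊕ μ) →
      ∃ φ : Matrix κ μ ℂ, pull (graphRows φ) t = 0 := by
  let S := symArray ℂ ε (d + 1) κ
  let P : ((Fin (d + 1) → κ) → ℂ) →ₗ[ℂ] S :=
    (symmetrize ε).codRestrict S (symmetrize_mem_symArray ε)
  let L : Matrix κ μ ℂ →ₗ[ℂ] S := ((d + 1).factorial : ℂ) • P ∘ₗ contractRows F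
  have factorial_ne_zero : ((d + 1).factorial : ℂ) ≠ 0 :=
    Nat.cast_ne_zero.mpr (Nat.factorial_ne_zero _)
  have L_surjective : Function.Surjective L := by
    rintro ⟨w, hw⟩
    obtain ⟨φ, hφ⟩ := exists_symmetrize_contractRows_eq hF hw
    refine ⟨((d + 1).factorial : ℂ)⁻¹ • φ, ?_⟩
    rw [LinearMap.smul_apply, map_smul, smul_inv_smul₀ factorial_ne_zero]
    exact Subtype.ext hφ
  have eq_L (φ : Matrix κ μ ℂ) :
      P (pull (graphRows φ) (symmetrize ε (extendRows F))) = L φ := by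
    refine Subtype.ext ?_
    change symmetrize ε (pull _ _) = ((d + 1).factorial : ℂ) • symmetrize ε (contractRows F φ)
    rw [pull_symmetrize, pull_graphRows_extendRows,
      symmetrize_eq_factorial_smul (symmetrize_mem_symArray ε _)]
  filter_upwards [eventually_exists_eq_zero (L := L.toContinuousLinearMap)
    ((P.toContinuousLinearMap.contDiff.comp contDiff_pull_graphRows).contDiffAt (n := 1))
    L_surjective eq_L]
  rintro t ⟨φ, hφ⟩ ht
  refine ⟨φ, (smul_eq_zero_iff_right factorial_ne_zero).mp ?_⟩
  rw [← symmetrize_eq_factorial_smul (pull_mem_symArray _ ht)]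
  exact congrArg Subtype.val hφ

end Smooth

theorem HasSeparatingArrays.hasIsotropicRows {ε : FormType} (h : HasSeparatingArrays ε d k m)
    {t : (Fin (d + 1) → Fin k ⊕ Fin m) → ℂ} (ht : t ∈ symArray ℂ ε (d + 1) (Fin k ⊕ Fin m)) :
    HasIsotropicRows t k := by
  obtain ⟨F, hF⟩ := h
  rcases forall_hasIsotropicRows_or_generically_not (d := d + 1) (ι := Fin k ⊕ Fin m) ε k with h | h
  · exact h ⟨t, ht⟩
  · let t₀ : symArray ℂ ε (d + 1) (Fin k ⊕ Fin m) := ⟨_, symmetrize_mem_symArray ε (extendRows F)⟩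
    have near_t₀ := (continuous_subtype_val.tendsto t₀).eventually
      (eventually_exists_pull_graphRows_eq_zero hF)
    obtain ⟨s, not_rows, rows⟩ :=
      ((mem_closure_iff_frequently.mp (h.dense t₀)).and_eventually near_t₀).exists
    obtain ⟨φ, hφ⟩ := rows s.2
    exact absurd
      ⟨_, linearIndependent_row_of_mul_eq_one (graphRows_mul_fromRows φ), hφ⟩ not_rows

theorem HasSeparatingArrays.hasIsotropicRows_fin {n : ℕ} {ε : FormType} (hk : k ≤ n)
    (h : HasSeparatingArrays ε d k (n - k)) {t : (Fin (d + 1) → Fin n) → ℂ}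
    (ht : t ∈ symArray ℂ ε (d + 1) (Fin n)) : HasIsotropicRows t k := by
  let e : Fin k ⊕ Fin (n - k) ≃ Fin n := finSumFinEquiv.trans (finCongr (Nat.add_sub_of_le hk))
  exact .of_comp_equiv e (h.hasIsotropicRows fun σ I => ht σ (e ∘ I))

end Sufficiency

section Coordinates

open Matrix

variable {K : Type*} {d k : ℕ} {V ι κ : Type*} [AddCommGroup V]

/-- The coordinate array of a multilinear form in a basis. -/
noncomputable def coordArray [CommRing K] [Module K V] (b : Module.Basis ι K V) :
    MultilinearMap K (fun _ : Fin d => V) K →ₗ[K] ((Fin d → ι) → K) where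
  toFun w I := w (b ∘ I)
  map_add' _ _ := rfl
  map_smul' _ _ := rfl

theorem coordArray_injective [CommRing K] [Module K V] (b : Module.Basis ι K V) :
    Function.Injective (coordArray (d := d) b) :=
  fun _ _ h => Module.Basis.ext_multilinear (fun _ => b) (congrFun h)

section CommRing

variable [CommRing K] [Module K V] (b : Module.Basis ι K V)

theorem pull_coordArray [Fintype ι] (w : MultilinearMap K (fun _ : Fin d => V) K) (v : κ → V)
    (J : Fin d → κ) : pull (of fun i => b.equivFun (v i)) (coordArray b w) J = w (v ∘ J) := by
  have expand : v ∘ J = fun s => ∑ i, b.equivFun (v (J s)) i • b i :=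
    funext fun s => (b.sum_equivFun (v (J s))).symm
  rw [expand, w.map_sum]
  exact Finset.sum_congr rfl fun I _ => (w.map_smul_univ _ _).symm

theorem coordArray_surjective [Finite ι] : Function.Surjective (coordArray (d := d) b) := by
  classical
  cases nonempty_fintype ι
  intro t
  let monomial (I : Fin d → ι) : MultilinearMap K (fun _ : Fin d => V) K :=
    (MultilinearMap.mkPiAlgebra K (Fin d) K).compLinearMap fun s => b.coord (I s)
  have monomial_apply (I J : Fin d → ι) :
      monomial I (b ∘ J) = Pi.single (M := fun _ => K) J 1 I := by
    change tensorPow d (of fun i => b.equivFun (b i)) J I = _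
    have one : (of fun i => b.equivFun (b i) : Matrix ι ι K) = 1 := by
      ext i j
      simp [Matrix.one_apply, Finsupp.single_apply]
    rw [one, tensorPow_one, Matrix.one_eq_pi_single]
  refine ⟨∑ I, t I • monomial I, funext fun J => ?_⟩
  change (∑ I, t I • monomial I) (b ∘ J) = t J
  simp [monomial_apply, Pi.single_apply]

theorem coordArray_mem_symArray_iff [Finite ι] {ε : FormType}
    {w : MultilinearMap K (fun _ : Fin d => V) K} :
    coordArray b w ∈ symArray K ε d ι ↔ ⇑w ∈ symArray K ε d V := by
  cases nonempty_fintype ι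
  refine ⟨fun h σ v => ?_, fun h σ I => h σ (b ∘ I)⟩
  have := pull_mem_symArray (of fun s => b.equivFun (v s)) h σ id
  rwa [pull_coordArray, pull_coordArray] at this

end CommRing

section Complex

variable [Module ℂ V] (b : Module.Basis ι ℂ V)

theorem hasIsotropicSubspace_iff [Fintype ι] (w : MultilinearMap ℂ (fun _ : Fin d => V) ℂ) :
    HasIsotropicSubspace w k ↔ HasIsotropicRows (coordArray b w) k := by
  have : FiniteDimensional ℂ V := .of_basis b
  constructor
  · rintro ⟨U, hU, hw⟩
    refine .of_submodule (U.map b.equivFun.toLinearMap) ?_ fun A hA => ?_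
    · rw [LinearEquiv.finrank_map_eq, hU]
    · choose v hv hvA using hA
      obtain rfl : of (fun i => b.equivFun (v i)) = A := funext hvA
      ext J
      exact (pull_coordArray b w v J).trans (hw _ fun s => hv (J s))
  · intro h
    obtain ⟨U, hU, h0⟩ := h.exists_submodule
    refine ⟨U.map b.equivFun.symm.toLinearMap, ?_, fun v hv => ?_⟩
    · rw [LinearEquiv.finrank_map_eq, hU]
    · have := h0 (of fun i => b.equivFun (v i)) fun i => (Submodule.mem_map_equiv _).mp (hv i)
      exact (pull_coordArray b w v id).symm.trans (congrFun this id)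

/-- The coordinate array of a symmetric form. -/
noncomputable def symFormCoord [Finite ι] : SymForm d V →ₗ[ℂ] symArray ℂ .symmetric d ι :=
  (coordArray b).restrict fun _ hw =>
    (coordArray_mem_symArray_iff b).mpr fun σ v => (hw σ v).trans (one_smul _ _).symm

theorem symFormCoord_bijective [Finite ι] : Function.Bijective (symFormCoord (d := d) b) := by
  refine ⟨fun w w' h => Subtype.ext (coordArray_injective b (congrArg Subtype.val h)), ?_⟩
  rintro ⟨t, ht⟩
  obtain ⟨w, rfl⟩ := coordArray_surjective b t
  have hw := (coordArray_mem_symArray_iff b).mp ht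
  exact ⟨⟨w, fun σ v => (hw σ v).trans (one_smul _ _)⟩, rfl⟩

/-- The coordinate array of an alternating form. -/
noncomputable def alternatingMapCoord [Finite ι] :
    (V [⋀^Fin d]→ₗ[ℂ] ℂ) →ₗ[ℂ] symArray ℂ .alternating d ι :=
  (coordArray b ∘ₗ AlternatingMap.toMultilinearMapLM (S := ℂ)).codRestrict _ fun _ =>
    (coordArray_mem_symArray_iff b).mpr fun σ v => AlternatingMap.map_perm _ v σ

theorem alternatingMapCoord_bijective [Finite ι] :
    Function.Bijective (alternatingMapCoord (d := d) b) := by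
  refine ⟨fun w w' h => AlternatingMap.coe_multilinearMap_injective
    (coordArray_injective b (congrArg Subtype.val h)), ?_⟩
  rintro ⟨t, ht⟩
  obtain ⟨w, rfl⟩ := coordArray_surjective b t
  have hw := (coordArray_mem_symArray_iff b).mp ht
  exact ⟨{ w with map_eq_zero_of_eq' := fun v i j hij hne =>
    apply_eq_zero_of_not_injective hw fun hv => hne (hv hij) }, rfl⟩

end Complex

end Coordinates

section Generic

variable {d k n : ℕ} {V : Type*} [AddCommGroup V] [Module ℂ V] [FiniteDimensional ℂ V]

theorem holdsGenerically_hasIsotropicRows_iff {ε : FormType} {ι : Type*} [Fintype ι] {c : Prop}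
    (hpos : c → ∀ t ∈ symArray ℂ ε d ι, HasIsotropicRows t k)
    (hneg : ¬ c → ∃ t ∈ symArray ℂ ε d ι, ¬ HasIsotropicRows t k) :
    HoldsGenerically fun t : symArray ℂ ε d ι =>
      (HasIsotropicRows (t : (Fin d → ι) → ℂ) k ↔ c) := by
  by_cases hc : c
  · exact holdsGenerically_of_forall fun t => iff_of_true (hpos hc t t.2) hc
  · obtain ⟨t, ht, not_rows⟩ := hneg hc
    rcases forall_hasIsotropicRows_or_generically_not (d := d) (ι := ι) ε k with h | h
    · exact absurd (h ⟨t, ht⟩) not_rows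
    · exact h.mono fun t ht => iff_of_false ht hc

theorem SymForm.holdsGenerically_hasIsotropicSubspace_iff (hn : Module.finrank ℂ V = n) {c : Prop}
    (hpos : c → ∀ t ∈ symArray ℂ .symmetric d (Fin n), HasIsotropicRows t k)
    (hneg : ¬ c → ∃ t ∈ symArray ℂ .symmetric d (Fin n), ¬ HasIsotropicRows t k) :
    HoldsGenerically fun w : SymForm d V =>
      (HasIsotropicSubspace (w : MultilinearMap ℂ (fun _ : Fin d => V) ℂ) k ↔ c) := by
  let b := Module.finBasisOfFinrankEq ℂ V hn
  refine ((holdsGenerically_hasIsotropicRows_iff hpos hneg).comp_linearEquiv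
    (.ofBijective _ (symFormCoord_bijective b))).mono fun w hw => ?_
  rwa [hasIsotropicSubspace_iff b]

theorem alternatingMap_holdsGenerically_hasIsotropicSubspace_iff (hn : Module.finrank ℂ V = n)
    {c : Prop} (hpos : c → ∀ t ∈ symArray ℂ .alternating d (Fin n), HasIsotropicRows t k)
    (hneg : ¬ c → ∃ t ∈ symArray ℂ .alternating d (Fin n), ¬ HasIsotropicRows t k) :
    HoldsGenerically fun w : V [⋀^Fin d]→ₗ[ℂ] ℂ =>
      (HasIsotropicSubspace w.toMultilinearMap k ↔ c) := by
  let b := Module.finBasisOfFinrankEq ℂ V hn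
  refine ((holdsGenerically_hasIsotropicRows_iff hpos hneg).comp_linearEquiv
    (.ofBijective _ (alternatingMapCoord_bijective b))).mono fun w hw => ?_
  rwa [hasIsotropicSubspace_iff b]

end Generic

section Bilinear

open Matrix

variable {K : Type*} [Field K] {k n : ℕ} {ι : Type*} [Fintype ι]

theorem finrank_add_finrank_le_of_dotProduct_eq_zero {U W : Submodule K (ι → K)}
    (h : ∀ u ∈ U, ∀ w ∈ W, u ⬝ᵥ w = 0) :
    Module.finrank K U + Module.finrank K W ≤ Fintype.card ι := by
  classical
  have map_le : U.map (dotProductEquiv K ι).toLinearMap ≤ W.dualAnnihilator := by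
    rintro _ ⟨u, hu, rfl⟩
    exact (Submodule.mem_dualAnnihilator _).mpr fun w hw => h u hu w hw
  have finrank_U := Submodule.finrank_mono map_le
  rw [LinearEquiv.finrank_map_eq] at finrank_U
  have finrank_W := Subspace.finrank_add_finrank_dualAnnihilator_eq W
  rw [Module.finrank_fintype_fun_eq_card] at finrank_W
  lia

theorem two_mul_finrank_add_rank_le {M : Matrix ι ι K} {U : Submodule K (ι → K)}
    (h : ∀ u ∈ U, ∀ v ∈ U, u ⬝ᵥ M *ᵥ v = 0) :
    2 * Module.finrank K U + M.rank ≤ 2 * Fintype.card ι := by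
  have orthogonal : Module.finrank K U + Module.finrank K (U.map M.mulVecLin) ≤ Fintype.card ι := by
    refine finrank_add_finrank_le_of_dotProduct_eq_zero fun u hu => ?_
    rintro _ ⟨v, hv, rfl⟩
    exact h u hu v hv
  have rank_nullity := M.mulVecLin.finrank_range_add_finrank_ker
  have rank_nullity_U := (M.mulVecLin.domRestrict U).finrank_range_add_finrank_ker
  rw [LinearMap.range_domRestrict] at rank_nullity_U
  have ker_le : Module.finrank K (M.mulVecLin.domRestrict U).ker ≤
      Module.finrank K M.mulVecLin.ker := by
    rw [LinearMap.ker_domRestrict, ← Submodule.finrank_map_subtype_eq]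
    exact Submodule.finrank_mono (Submodule.map_comap_le _ _)
  rw [Module.finrank_fintype_fun_eq_card] at rank_nullity
  rw [Matrix.rank]
  lia

/-- The coordinate array of the bilinear form with a given Gram matrix. -/
def bilinearArray (M : Matrix ι ι K) : (Fin 2 → ι) → K :=
  fun I => M (I 0) (I 1)

theorem pull_bilinearArray {κ : Type*} (A : Matrix κ ι K) (M : Matrix ι ι K) (J : Fin 2 → κ) :
    pull A (bilinearArray M) J = A (J 0) ⬝ᵥ M *ᵥ A (J 1) := by
  rw [pull_apply, ← (finTwoArrowEquiv ι).symm.sum_comp, Fintype.sum_prod_type]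
  refine Finset.sum_congr rfl fun i _ => ?_
  rw [mulVec, dotProduct, Finset.mul_sum]
  refine Finset.sum_congr rfl fun j _ => ?_
  rw [tensorPow_apply, Fin.prod_univ_two, mul_assoc, mul_comm (A (J 1) _)]
  rfl

theorem two_mul_add_rank_le_of_hasIsotropicRows {M : Matrix ι ι K}
    (h : HasIsotropicRows (bilinearArray M) k) : 2 * k + M.rank ≤ 2 * Fintype.card ι := by
  obtain ⟨U, rfl, hU⟩ := h.exists_submodule
  refine two_mul_finrank_add_rank_le fun u hu v hv => ?_
  have pull_eq := hU (of ![u, v]) fun i => by fin_cases i <;> assumption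
  exact (pull_bilinearArray (of ![u, v]) M id).symm.trans (congrFun pull_eq id)

omit [Fintype ι] in
theorem bilinearArray_mem_symArray {ε : FormType} {M : Matrix ι ι K}
    (hM : ∀ i j, M j i = ε.permChar (Equiv.swap (0 : Fin 2) 1) • M i j) :
    bilinearArray M ∈ symArray K ε 2 ι := by
  intro σ I
  obtain rfl | rfl : σ = 1 ∨ σ = Equiv.swap 0 1 := by decide +revert
  · rw [map_one, one_smul, Equiv.Perm.coe_one, Function.comp_id]
  · exact hM (I 0) (I 1)

theorem exists_symmetric_not_hasIsotropicRows (h : n < 2 * k) :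
    ∃ t ∈ symArray ℂ .symmetric 2 (Fin n), ¬ HasIsotropicRows t k := by
  refine ⟨bilinearArray 1, bilinearArray_mem_symArray fun i j => ?_, fun hk => ?_⟩
  · exact (congrFun (congrFun transpose_one i) j).trans (one_smul _ _).symm
  · have le := two_mul_add_rank_le_of_hasIsotropicRows hk
    rw [rank_one, Fintype.card_fin] at le
    lia

/-- A skew-symmetric matrix of the largest possible rank, supported on the antidiagonal. -/
def skewGram (n : ℕ) : Matrix (Fin n) (Fin n) ℂ :=
  (diagonal fun i : Fin n => ((i.rev : ℕ) - (i : ℕ) : ℂ)).submatrix id Fin.revPerm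

theorem skewGram_swap (i j : Fin n) : skewGram n j i = -skewGram n i j := by
  simp only [skewGram, submatrix_apply, diagonal_apply, id, Fin.revPerm_apply]
  by_cases hij : j = i.rev
  · subst hij
    rw [if_pos rfl, if_pos (Fin.rev_rev i).symm, Fin.rev_rev, neg_sub]
  · rw [if_neg hij, if_neg fun h => hij (Fin.rev_eq_iff.mp h.symm), neg_zero]

theorem le_rank_skewGram (n : ℕ) : n ≤ (skewGram n).rank + n % 2 := by
  let w (i : Fin n) : ℂ := (i.rev : ℕ) - (i : ℕ)
  have w_eq_zero_iff (i : Fin n) : w i = 0 ↔ 2 * (i : ℕ) + 1 = n := by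
    rw [sub_eq_zero, Nat.cast_inj, Fin.val_rev]
    lia
  have card_zero_le : Fintype.card {i // w i = 0} ≤ n % 2 := by
    rcases isEmpty_or_nonempty {i // w i = 0} with _ | ⟨i, hi⟩
    · exact Fintype.card_eq_zero.trans_le (Nat.zero_le _)
    · have n_odd := (w_eq_zero_iff i).mp hi
      have eq_i (j : {i // w i = 0}) : j = ⟨i, hi⟩ := by
        have hj := (w_eq_zero_iff j).mp j.2
        exact Subtype.ext (Fin.ext (by lia))
      exact (Fintype.card_eq_one_iff.mpr ⟨_, eq_i⟩).trans_le (by lia)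
  have rank_eq : (skewGram n).rank = Fintype.card {i // w i ≠ 0} :=
    (rank_submatrix _ (Equiv.refl _) Fin.revPerm).trans (rank_diagonal w)
  have card_add := Fintype.card_subtype_compl fun i => w i = 0
  rw [Fintype.card_fin] at card_add
  lia

theorem exists_alternating_not_hasIsotropicRows (h : n + n % 2 < 2 * k) :
    ∃ t ∈ symArray ℂ .alternating 2 (Fin n), ¬ HasIsotropicRows t k := by
  refine ⟨bilinearArray (skewGram n), bilinearArray_mem_symArray fun i j => ?_, fun hk => ?_⟩
  · change skewGram n j i = Equiv.Perm.sign (Equiv.swap (0 : Fin 2) 1) • skewGram n i j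
    rw [Equiv.Perm.sign_swap zero_ne_one, skewGram_swap, Units.neg_smul, one_smul]
  · have le := two_mul_add_rank_le_of_hasIsotropicRows hk
    have le_rank := le_rank_skewGram n
    rw [Fintype.card_fin] at le
    lia

end Bilinear

section CorankTwo

open Matrix

section Contraction

variable {K : Type*} [Field K] {ε : FormType} {d k : ℕ} {ι κ : Type*} [Fintype ι]

theorem flatten_pull (A : Matrix κ ι K) (g : (Fin (d + 1) → ι) → K) :
    flatten (pull A g) = A * flatten g * (tensorPow d A)ᵀ := by
  ext i J
  rw [Matrix.mul_assoc, mul_apply]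
  refine (pull_succ A g (Fin.cons i J)).trans (Finset.sum_congr rfl fun x _ => ?_)
  rw [mul_apply]
  exact congrArg (A i x * ·) (Finset.sum_congr rfl fun I _ => mul_comm _ _)

/-- Contraction with `t` annihilates the forms of degree `d + 1` living on an isotropic subspace
of `t`. -/
theorem eq_zero_of_hasIsotropicRows {t : (Fin d → ι) → K}
    (ht : ∀ g ∈ symArray K ε (d + 1) ι, flatten g *ᵥ t = 0 → g = 0) (h : HasIsotropicRows t k)
    {g : (Fin (d + 1) → Fin k) → K} (hg : g ∈ symArray K ε (d + 1) (Fin k)) : g = 0 := by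
  classical
  obtain ⟨A, e, hA, hAt⟩ := h.exists_normalized
  have right_inverse : A * (1 : Matrix ι ι K).submatrix id e = 1 :=
    (mul_submatrix_one (.refl ι) e A).trans hA
  have left_inverse : ((1 : Matrix ι ι K).submatrix id e)ᵀ * Aᵀ = 1 := by
    rw [← transpose_mul, right_inverse, transpose_one]
  have pull_eq_zero : pull Aᵀ g = 0 := by
    refine ht _ (pull_mem_symArray _ hg) ?_
    have transpose_tensorPow : (tensorPow d Aᵀ)ᵀ = tensorPow d A := rfl
    rw [flatten_pull, transpose_tensorPow, ← mulVec_mulVec]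
    exact (congrArg _ hAt).trans (mulVec_zero _)
  rw [← pull_one g, ← left_inverse, pull_mul, pull_eq_zero, map_zero]

omit [Fintype ι] in
theorem flatten_apply_mem_symArray {g : (Fin (d + 1) → ι) → K}
    (hg : g ∈ symArray K ε (d + 1) ι) (i : ι) : flatten g i ∈ symArray K ε d ι := by
  intro σ I
  let τ := Equiv.Perm.decomposeFin.symm (0, σ)
  have permChar_eq : ε.permChar τ = ε.permChar σ := by
    cases ε
    · rfl
    · simp [FormType.permChar, τ]
  have cons_comp : (Fin.cons i (I ∘ σ) : Fin (d + 1) → ι) = Fin.cons i I ∘ τ := by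
    ext s
    induction s using Fin.cases with
    | zero => simp [τ]
    | succ s => simp [τ]
  exact (congrArg g cons_comp).trans ((hg τ _).trans (congrArg (· • _) permChar_eq))

theorem flatten_mulVec_symmetrize {g : (Fin (d + 1) → ι) → K}
    (hg : g ∈ symArray K ε (d + 1) ι) (f : (Fin d → ι) → K) :
    flatten g *ᵥ symmetrize ε f = (d.factorial : K) • flatten g *ᵥ f := by
  ext i
  refine (sum_mul_symmetrize ε (flatten g i) f).trans ?_
  rw [symmetrize_eq_factorial_smul (flatten_apply_mem_symArray hg i)]
  exact smul_dotProduct _ _ _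

end Contraction

variable {d : ℕ}

theorem ne_rev_of_even (hd : Even d) (c : Fin (d + 2)) : c ≠ c.rev := by
  obtain ⟨m, rfl⟩ := hd
  rw [Ne, Fin.ext_iff, Fin.val_rev]
  lia

/-- The increasing enumeration of the complement of the pair `{c, rev c}`. -/
noncomputable def complementPair (hd : Even d) (c : Fin (d + 2)) : Fin d ↪o Fin (d + 2) :=
  ({c, c.rev}ᶜ : Finset (Fin (d + 2))).orderEmbOfFin <| by
    rw [Finset.card_compl, Finset.card_pair (ne_rev_of_even hd c), Fintype.card_fin,
      Nat.add_sub_cancel]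

theorem range_complementPair (hd : Even d) (c : Fin (d + 2)) :
    Set.range (complementPair hd c) = {c, c.rev}ᶜ := by
  rw [complementPair, Finset.range_orderEmbOfFin, Finset.coe_compl, Finset.coe_pair]

theorem complementPair_rev (hd : Even d) (c : Fin (d + 2)) :
    complementPair hd c.rev = complementPair hd c := by
  have : ({c.rev, c.rev.rev} : Finset (Fin (d + 2))) = {c, c.rev} := by
    rw [Fin.rev_rev, Finset.pair_comm]
  simp only [complementPair, this]

/-- The sum of the monomials omitting a pair `{c, rev c}`, each counted twice. -/
noncomputable def pairArray (K : Type*) [Field K] (hd : Even d) : (Fin d → Fin (d + 2)) → K :=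
  ∑ c, Pi.single (complementPair hd c) 1

theorem flatten_mulVec_pairArray {K : Type*} [Field K] [CharZero K] (hd : Even d)
    {g : (Fin (d + 1) → Fin (d + 2)) → K} (hg : g ∈ symArray K .alternating (d + 1) (Fin (d + 2)))
    (i : Fin (d + 2)) :
    (flatten g *ᵥ pairArray K hd) i = 2 * g (Fin.cons i (complementPair hd i)) := by
  have apply_eq_zero (c) (hc : c ∉ ({i, i.rev} : Finset _)) :
      g (Fin.cons i (complementPair hd c)) = 0 := by
    refine apply_eq_zero_of_not_injective hg fun h => (Fin.cons_injective_iff.mp h).1 ?_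
    rw [range_complementPair]
    rintro (rfl | rfl) <;> simp at hc
  rw [pairArray, mulVec_sum, Finset.sum_apply]
  simp only [mulVec_single_one]
  calc ∑ c, g (Fin.cons i (complementPair hd c))
      = ∑ c ∈ {i, i.rev}, g (Fin.cons i (complementPair hd c)) :=
        (Finset.sum_subset (Finset.subset_univ _) fun c _ => apply_eq_zero c).symm
    _ = 2 * g (Fin.cons i (complementPair hd i)) := by
        rw [Finset.sum_pair (ne_rev_of_even hd i), complementPair_rev, two_mul]

theorem eq_zero_of_flatten_mulVec_pairArray {K : Type*} [Field K] [CharZero K] (hd : Even d)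
    {g : (Fin (d + 1) → Fin (d + 2)) → K} (hg : g ∈ symArray K .alternating (d + 1) (Fin (d + 2)))
    (h : flatten g *ᵥ pairArray K hd = 0) : g = 0 := by
  have apply_cons (i) : g (Fin.cons i (complementPair hd i)) = 0 := by
    have := congrFun h i
    rwa [flatten_mulVec_pairArray hd hg, Pi.zero_apply, mul_eq_zero_iff_left two_ne_zero] at this
  ext I
  by_cases hI : I.Injective
  · obtain ⟨x, hx⟩ : ∃ x, x ∉ Set.range I := by
      by_contra! surjective
      have card_le := Fintype.card_le_of_surjective I surjective
      rw [Fintype.card_fin, Fintype.card_fin] at card_le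
      lia
    let L : Fin (d + 1) → Fin (d + 2) := Fin.cons x.rev (complementPair hd x)
    have range_L (y) (hy : y ≠ x) : y ∈ Set.range L := by
      rw [Fin.range_cons, range_complementPair]
      by_cases hyx : y = x.rev <;> simp [hy, hyx]
    choose σ hσ using fun s => range_L (I s) fun h => hx ⟨s, h⟩
    have σ_injective : σ.Injective := fun a b h => hI (by rw [← hσ a, ← hσ b, h])
    let τ := Equiv.ofBijective σ (Finite.injective_iff_bijective.mp σ_injective)
    obtain rfl : L ∘ τ = I := funext hσ
    have apply_L := apply_cons x.rev
    rw [complementPair_rev] at apply_L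
    exact (hg τ L).trans ((congrArg _ apply_L).trans (smul_zero _))
  · exact apply_eq_zero_of_not_injective hg hI

theorem hasSeparatingArrays_of_even (hd : Even d) : HasSeparatingArrays .alternating d (d + 2) 1 :=
  ⟨replicateCol (Fin 1) (pairArray ℂ hd), fun _ hg hg_mul =>
    eq_zero_of_flatten_mulVec_pairArray hd hg (funext fun i => congrFun (congrFun hg_mul i) 0)⟩

theorem exists_not_hasIsotropicRows_corank_two (hd : Even d) :
    ∃ t ∈ symArray ℂ .alternating d (Fin (d + 2)), ¬ HasIsotropicRows t (d + 1) := by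
  refine ⟨_, symmetrize_mem_symArray _ (pairArray ℂ hd), fun h => ?_⟩
  have finrank_eq := finrank_symArray ℂ .alternating (d + 1) (d + 1)
  rw [FormType.formDim, Nat.choose_self] at finrank_eq
  have eq_bot : symArray ℂ .alternating (d + 1) (Fin (d + 1)) = ⊥ := by
    refine (Submodule.eq_bot_iff _).mpr fun g hg => ?_
    refine eq_zero_of_hasIsotropicRows (fun g hg hgt => ?_) h hg
    rw [flatten_mulVec_symmetrize hg, smul_eq_zero_iff_right
      (Nat.cast_ne_zero.mpr d.factorial_ne_zero)] at hgt
    exact eq_zero_of_flatten_mulVec_pairArray hd hg hgt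
  rw [eq_bot, finrank_bot] at finrank_eq
  exact zero_ne_one finrank_eq

end CorankTwo

section DimensionSeven

open Matrix

theorem matrix_rank_add_le {K ι κ : Type*} [Field K] [Fintype ι] [Finite κ] (A B : Matrix κ ι K) :
    (A + B).rank ≤ A.rank + B.rank := by
  rw [Matrix.rank, mulVecLin_add]
  exact (Submodule.finrank_mono (LinearMap.range_add_le _ _)).trans
    (Submodule.finrank_add_le_finrank_add_finrank _ _)

section CommRing

variable {K : Type*} [CommRing K]

/-- The supports of the monomials of `g2Form`. -/
def g2Triple : Fin 5 → Fin 3 → Fin 7 :=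
  ![![0, 1, 4], ![0, 2, 5], ![0, 3, 6], ![1, 2, 3], ![4, 5, 6]]

/-- The generic alternating form of degree three in dimension seven, whose stabilizer has identity
component `G₂`. -/
noncomputable def g2Form (K : Type*) [CommRing K] : (Fin 7 → K) [⋀^Fin 3]→ₗ[K] K :=
  ∑ a, (detRowAlternating (R := K)).compLinearMap (LinearMap.funLeft K K (g2Triple a))

/-- The Gram matrix of the contraction of `g2Form` with a vector. -/
def g2Matrix (u : Fin 7 → K) : Matrix (Fin 7) (Fin 7) K :=
  !![0, -u 4, -u 5, -u 6, u 1, u 2, u 3;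
    u 4, 0, -u 3, u 2, -u 0, 0, 0;
    u 5, u 3, 0, -u 1, 0, -u 0, 0;
    u 6, -u 2, u 1, 0, 0, 0, -u 0;
    -u 1, u 0, 0, 0, 0, -u 6, u 5;
    -u 2, 0, u 0, 0, u 6, 0, -u 4;
    -u 3, 0, 0, u 0, -u 5, u 4, 0]

theorem dotProduct_g2Matrix_mulVec (u v w : Fin 7 → K) :
    w ⬝ᵥ g2Matrix u *ᵥ v = g2Form K ![u, v, w] := by
  have g2Form_eq : g2Form K ![u, v, w] =
      ∑ a, det (of fun s c => ![u, v, w] s (g2Triple a c)) := by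
    simp only [g2Form, Fin.sum_univ_five]
    rfl
  simp only [g2Form_eq, Fin.sum_univ_five, det_fin_three, dotProduct, mulVec, Fin.sum_univ_seven]
  simp [g2Matrix, g2Triple]
  ring

/-- The quadratic form on `K⁷` invariant under the stabilizer of `g2Form`. -/
def g2Quadric (u : Fin 7 → K) : K :=
  u 0 ^ 2 - (u 1 * u 4 + u 2 * u 5 + u 3 * u 6)

/-- The Gram matrix of the polar form of `g2Quadric`. -/
def g2Polar (K : Type*) [CommRing K] : Matrix (Fin 7) (Fin 7) K :=
  !![2, 0, 0, 0, 0, 0, 0;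
    0, 0, 0, 0, -1, 0, 0;
    0, 0, 0, 0, 0, -1, 0;
    0, 0, 0, 0, 0, 0, -1;
    0, -1, 0, 0, 0, 0, 0;
    0, 0, -1, 0, 0, 0, 0;
    0, 0, 0, -1, 0, 0, 0]

/-- Twice the inverse of `g2Polar`. -/
def g2CoPolar (K : Type*) [CommRing K] : Matrix (Fin 7) (Fin 7) K :=
  !![1, 0, 0, 0, 0, 0, 0;
    0, 0, 0, 0, -2, 0, 0;
    0, 0, 0, 0, 0, -2, 0;
    0, 0, 0, 0, 0, 0, -2;
    0, -2, 0, 0, 0, 0, 0;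
    0, 0, -2, 0, 0, 0, 0;
    0, 0, 0, -2, 0, 0, 0]

theorem g2CoPolar_mul_g2Polar : g2CoPolar K * g2Polar K = (2 : K) • 1 := by
  ext i j
  fin_cases i <;> fin_cases j <;>
    simp [g2CoPolar, g2Polar, mul_apply, Fin.sum_univ_seven, one_apply]

theorem dotProduct_g2Polar_mulVec (u v : Fin 7 → K) :
    u ⬝ᵥ g2Polar K *ᵥ v = g2Quadric (u + v) - g2Quadric u - g2Quadric v := by
  simp only [dotProduct, mulVec, Fin.sum_univ_seven]
  simp [g2Polar, g2Quadric]
  ring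

/-- In terms of the cross product `u × v` of imaginary octonions, this is the identity expressing
`u × (u × v)` as a combination of `u` and `v`. -/
theorem g2Matrix_mul_g2CoPolar_mul_g2Matrix (u : Fin 7 → K) :
    g2Matrix u * g2CoPolar K * g2Matrix u +
      vecMulVec (g2Polar K *ᵥ u) (g2Polar K *ᵥ u) = (2 * g2Quadric u) • g2Polar K := by
  refine mulVec_injective (funext fun v => ?_)
  simp only [add_mulVec, ← mulVec_mulVec, vecMulVec_mulVec, smul_mulVec]
  ext i
  fin_cases i <;>
    simp [g2Matrix, g2CoPolar, g2Polar, g2Quadric, mulVec, dotProduct, Fin.sum_univ_seven] <;>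
    ring

end CommRing

variable {K : Type*} [Field K] [NeZero (2 : K)]

theorem rank_g2Polar : (g2Polar K).rank = 7 := by
  have left_inverse : (2⁻¹ : K) • g2CoPolar K * g2Polar K = 1 := by
    rw [Matrix.smul_mul, g2CoPolar_mul_g2Polar, inv_smul_smul₀ two_ne_zero]
  exact (rank_of_isUnit _ (.of_mul_eq_one_right _ left_inverse)).trans (Fintype.card_fin 7)

theorem six_le_rank_g2Matrix {u : Fin 7 → K} (hu : g2Quadric u ≠ 0) :
    6 ≤ (g2Matrix u).rank := by
  suffices 7 ≤ (g2Matrix u).rank + 1 by lia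
  calc 7 = ((2 * g2Quadric u) • g2Polar K).rank := by
        rw [rank_smul_of_mem_nonZeroDivisors _
          (mem_nonZeroDivisors_of_ne_zero (mul_ne_zero two_ne_zero hu)), rank_g2Polar]
    _ ≤ (g2Matrix u * g2CoPolar K * g2Matrix u).rank +
          (vecMulVec (g2Polar K *ᵥ u) (g2Polar K *ᵥ u)).rank := by
        rw [← g2Matrix_mul_g2CoPolar_mul_g2Matrix]
        exact matrix_rank_add_le _ _
    _ ≤ (g2Matrix u).rank + 1 := add_le_add (rank_mul_le_right _ _) (rank_vecMulVec_le _ _)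

theorem finrank_le_four_of_g2Form_eq_zero {U : Submodule K (Fin 7 → K)}
    (h : ∀ v, (∀ i, v i ∈ U) → g2Form K v = 0) : Module.finrank K U ≤ 4 := by
  by_cases hQ : ∀ u ∈ U, g2Quadric u = 0
  · have le := two_mul_finrank_add_rank_le (M := g2Polar K) (U := U) fun u hu v hv => by
      rw [dotProduct_g2Polar_mulVec, hQ _ (U.add_mem hu hv), hQ u hu, hQ v hv, sub_zero, sub_zero]
    rw [rank_g2Polar, Fintype.card_fin] at le
    lia
  · push Not at hQ
    obtain ⟨u, hu, hQu⟩ := hQ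
    have le := two_mul_finrank_add_rank_le (M := g2Matrix u) (U := U) fun w hw v hv => by
      rw [dotProduct_g2Matrix_mulVec]
      exact h _ fun i => by fin_cases i <;> assumption
    have le_rank := six_le_rank_g2Matrix hQu
    rw [Fintype.card_fin] at le
    lia

theorem exists_not_hasIsotropicRows_seven :
    ∃ t ∈ symArray ℂ .alternating 3 (Fin 7), ¬ HasIsotropicRows t 5 := by
  refine ⟨_, (alternatingMapCoord (Pi.basisFun ℂ (Fin 7)) (g2Form ℂ)).2, fun h => ?_⟩
  obtain ⟨U, finrank_U, hU⟩ :=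
    (hasIsotropicSubspace_iff (Pi.basisFun ℂ (Fin 7)) (g2Form ℂ).toMultilinearMap).mpr h
  have le := finrank_le_four_of_g2Form_eq_zero hU
  lia

end DimensionSeven

section Numerics

theorem le_max_of_monotone_sub {f : ℕ → ℤ} (hf : Monotone fun r => f (r + 1) - f r) {a b r : ℕ}
    (har : a ≤ r) (hrb : r ≤ b) : f r ≤ max (f a) (f b) := by
  rcases le_total 0 (f (r + 1) - f r) with h | h
  · have increasing : MonotoneOn f (Set.Ici r) :=
      monotoneOn_of_le_add_one Set.ordConnected_Ici fun s _ hs _ => sub_nonneg.mp (h.trans (hf hs))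
    exact (increasing Set.self_mem_Ici hrb hrb).trans (le_max_right _ _)
  · have decreasing : AntitoneOn f (Set.Iic r) :=
      antitoneOn_of_add_one_le Set.ordConnected_Iic fun s _ hs _ => sub_nonpos.mp ((hf hs).trans h)
    exact (decreasing har Set.self_mem_Iic har).trans (le_max_left _ _)

theorem choose_add_mul_sub_le {p d c a b r B : ℕ} (har : a ≤ r) (hrb : r ≤ b)
    (ha : (p + a).choose d + c * (b - a) ≤ B) (hb : (p + b).choose d ≤ B) :
    (p + r).choose d + c * (b - r) ≤ B := by
  let f (s : ℕ) : ℤ := (p + s).choose d + c * (b - s)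
  have sub_monotone : Monotone fun s => f (s + 1) - f s := by
    cases d with
    | zero => exact fun s s' _ => by simp only [f, Nat.choose_zero_right]; push_cast; linarith
    | succ e =>
      have sub_eq (s : ℕ) : f (s + 1) - f s = (p + s).choose e - c := by
        simp only [f, ← Nat.add_assoc, Nat.choose_succ_succ']
        push_cast
        ring
      intro s s' h
      simp only [sub_eq]
      gcongr
  have le_max := le_max_of_monotone_sub sub_monotone har hrb
  have le : max (f a) (f b) ≤ B := by
    refine max_le ?_ ?_
    · zify [har.trans hrb] at ha
      exact ha
    · simpa only [f, sub_self, mul_zero, add_zero, Nat.cast_le] using hb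
  zify [hrb]
  exact le_max.trans le

theorem le_choose_succ (e j : ℕ) : j ≤ (e + j).choose (e + 1) := by
  induction e with
  | zero => rw [Nat.zero_add, Nat.choose_one_right]
  | succ e ih =>
    rw [Nat.add_right_comm, Nat.choose_succ_succ']
    exact ih.trans (Nat.le_add_right _ _)

theorem succ_mul_lt_choose_of_le {e₀ e j c : ℕ} (he : e₀ ≤ e) (hc : c ≤ j)
    (h : (e₀ + 1) * c < (e₀ + j).choose e₀) : (e + 1) * c < (e + j).choose e := by
  induction e, he using Nat.le_induction with
  | base => exact h
  | succ e _ ih =>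
    calc (e + 1 + 1) * c = (e + 1) * c + c := add_one_mul _ _
      _ < (e + j).choose e + (e + j).choose (e + 1) :=
        add_lt_add_of_lt_of_le ih (hc.trans (le_choose_succ e j))
      _ = (e + 1 + j).choose (e + 1) := by rw [Nat.add_right_comm, Nat.choose_succ_succ']

theorem two_add_choose_two_mul_two (j : ℕ) : (2 + j).choose 2 * 2 = (j + 2) * (j + 1) := by
  rw [Nat.add_comm, ← Nat.add_one_mul_choose_eq, Nat.choose_one_right]

theorem succ_mul_pred_lt_choose {e k : ℕ} (he : 2 ≤ e) (hk : 1 ≤ k) :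
    (e + 1) * (k - 1) < (e + k).choose e := by
  refine succ_mul_lt_choose_of_le he (Nat.sub_le k 1) ?_
  obtain ⟨j, rfl⟩ := Nat.exists_eq_add_of_le' hk
  have := two_add_choose_two_mul_two (j + 1)
  rw [Nat.add_sub_cancel]
  nlinarith only [this, Nat.le_mul_self j]

theorem succ_mul_lt_choose {e j : ℕ} (he : 2 ≤ e) (hj : 2 ≤ j) (hne : ¬ (e = 2 ∧ j = 2)) :
    (e + 1) * j < (e + j).choose e := by
  rcases hj.eq_or_lt with rfl | hj
  · exact succ_mul_lt_choose_of_le (e₀ := 3) (by lia) le_rfl (by decide)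
  · refine succ_mul_lt_choose_of_le he le_rfl ?_
    have := two_add_choose_two_mul_two j
    nlinarith only [this, hj]

theorem div_add_le_iff {F k n : ℕ} (hk : 1 ≤ k) :
    (F : ℚ) / k + k ≤ n ↔ k ≤ n ∧ F ≤ k * (n - k) := by
  have iff_of_le (hkn : k ≤ n) : (F : ℚ) / k + k ≤ n ↔ F ≤ k * (n - k) := by
    rw [← le_sub_iff_add_le, div_le_iff₀ (by exact_mod_cast hk), ← Nat.cast_sub hkn, mul_comm]
    exact_mod_cast Iff.rfl
  refine ⟨fun h => ?_, fun ⟨hkn, h⟩ => (iff_of_le hkn).mpr h⟩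
  have hkn : k ≤ n := by exact_mod_cast (le_add_of_nonneg_left (by positivity)).trans h
  exact ⟨hkn, (iff_of_le hkn).mp h⟩

end Numerics

section Separating

variable {d k m : ℕ}

theorem formDim_symmetric_mul (d r : ℕ) :
    FormType.symmetric.formDim (d + 1) r * (d + 1) = r * (d + r).choose d := by
  rw [FormType.formDim, Nat.add_right_comm, Nat.add_sub_cancel, Nat.choose_succ_right_eq,
    Nat.add_sub_cancel_left, mul_comm]

theorem formDim_alternating_mul (d s : ℕ) :
    FormType.alternating.formDim (d + 1) (s + 1) * (d + 1) = (s + 1) * s.choose d :=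
  (Nat.add_one_mul_choose_eq s d).symm

theorem hasSeparatingArrays_zero (ε : FormType) (hm : 1 ≤ m) : HasSeparatingArrays ε 0 k m := by
  refine ⟨fun _ _ => 1, fun g _ h => funext fun I => ?_⟩
  have apply_eq : ∑ J, g (Fin.cons (I 0) J) * 1 = 0 := congrFun (congrFun h (I 0)) ⟨0, hm⟩
  rwa [Fintype.sum_unique, mul_one, Subsingleton.elim default (Fin.tail I),
    Fin.cons_self_tail] at apply_eq

theorem hasSeparatingArrays_symmetric_of_choose_le
    (h : ∀ r, 1 ≤ r → r ≤ k → (d + r).choose d + (d + 1) * (k - r) ≤ (d + 1) * m) :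
    HasSeparatingArrays .symmetric d k m := by
  refine hasSeparatingArrays_of_forall_rank fun r hrk pos => ?_
  have hr : 1 ≤ r := Nat.one_le_iff_ne_zero.mpr fun hr => by
    rw [hr, FormType.formDim, Nat.add_zero, Nat.add_sub_cancel, Nat.choose_succ_self] at pos
    exact lt_irrefl 0 pos
  refine Nat.le_of_mul_le_mul_right (c := d + 1) ?_ d.succ_pos
  calc (r * (k - r) + FormType.symmetric.formDim (d + 1) r) * (d + 1)
      = r * ((d + r).choose d + (d + 1) * (k - r)) := by
        rw [add_mul, formDim_symmetric_mul]
        ring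
    _ ≤ r * ((d + 1) * m) := Nat.mul_le_mul_left r (h r hr hrk)
    _ = r * m * (d + 1) := by ring

theorem hasSeparatingArrays_alternating_of_choose_le
    (h : ∀ s, d ≤ s → s < k → s.choose d + (d + 1) * (k - 1 - s) ≤ (d + 1) * m) :
    HasSeparatingArrays .alternating d k m := by
  refine hasSeparatingArrays_of_forall_rank fun r hrk pos => ?_
  have hr : d + 1 ≤ r := Nat.le_of_not_lt fun hr => pos.ne' (Nat.choose_eq_zero_of_lt hr)
  obtain ⟨s, rfl⟩ := Nat.exists_eq_add_of_le' (d.succ_pos.trans_le hr)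
  refine Nat.le_of_mul_le_mul_right (c := d + 1) ?_ d.succ_pos
  calc ((s + 1) * (k - (s + 1)) + FormType.alternating.formDim (d + 1) (s + 1)) * (d + 1)
      = (s + 1) * (s.choose d + (d + 1) * (k - 1 - s)) := by
        rw [add_mul, formDim_alternating_mul, Nat.add_comm s 1, Nat.sub_add_eq]
        ring
    _ ≤ (s + 1) * ((d + 1) * m) := Nat.mul_le_mul_left _ (h s (by lia) (by lia))
    _ = (s + 1) * m * (d + 1) := by ring

theorem hasSeparatingArrays_symmetric_two (h : k ≤ m) : HasSeparatingArrays .symmetric 1 k m :=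
  hasSeparatingArrays_symmetric_of_choose_le fun r _ _ => by
    rw [Nat.choose_one_right]
    lia

theorem hasSeparatingArrays_alternating_two (h : k ≤ m + 1) :
    HasSeparatingArrays .alternating 1 k m :=
  hasSeparatingArrays_alternating_of_choose_le fun s _ _ => by
    rw [Nat.choose_one_right]
    lia

theorem hasSeparatingArrays_symmetric (hd : 2 ≤ d) (hk : 1 ≤ k)
    (h : FormType.symmetric.formDim (d + 1) k ≤ k * m) : HasSeparatingArrays .symmetric d k m := by
  have choose_le : (d + k).choose d ≤ (d + 1) * m := by
    refine Nat.le_of_mul_le_mul_left (c := k) ?_ hk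
    rw [← formDim_symmetric_mul, mul_comm (d + 1), ← mul_assoc]
    exact Nat.mul_le_mul_right _ h
  have hkm : k ≤ m := by
    have := Nat.lt_of_mul_lt_mul_left ((succ_mul_pred_lt_choose hd hk).trans_le choose_le)
    lia
  refine hasSeparatingArrays_symmetric_of_choose_le fun r hr hrk =>
    choose_add_mul_sub_le hr hrk ?_ choose_le
  calc (d + 1).choose d + (d + 1) * (k - 1) = (d + 1) * k := by
        rw [Nat.choose_succ_self_right, ← mul_one_add, Nat.add_sub_cancel' hk]
    _ ≤ (d + 1) * m := Nat.mul_le_mul_left _ hkm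

theorem choose_le_of_formDim_alternating_le
    (h : FormType.alternating.formDim (d + 1) (k + 1) ≤ (k + 1) * m) :
    k.choose d ≤ (d + 1) * m := by
  refine Nat.le_of_mul_le_mul_left (c := k + 1) ?_ k.succ_pos
  rw [← formDim_alternating_mul, mul_comm (d + 1), ← mul_assoc]
  exact Nat.mul_le_mul_right _ h

theorem hasSeparatingArrays_alternating_of_lt (hkm : k < m + (d + 1))
    (h : FormType.alternating.formDim (d + 1) k ≤ k * m) :
    HasSeparatingArrays .alternating d k m := by
  refine hasSeparatingArrays_alternating_of_choose_le fun s hds hsk => ?_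
  obtain ⟨j, rfl⟩ := Nat.exists_eq_add_of_lt hsk
  have choose_le := choose_le_of_formDim_alternating_le h
  have at_degree : (0 + d).choose d + (d + 1) * (s + j - d) ≤ (d + 1) * m := by
    calc (0 + d).choose d + (d + 1) * (s + j - d) ≤ (d + 1) * (1 + (s + j - d)) := by
          rw [zero_add, Nat.choose_self, mul_add]
          lia
      _ ≤ (d + 1) * m := Nat.mul_le_mul_left _ (by lia)
  have := choose_add_mul_sub_le (p := 0) (b := s + j) hds (by lia) at_degree (by rwa [zero_add])
  rwa [zero_add] at this

theorem hasSeparatingArrays_alternating (hd : 2 ≤ d)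
    (h : FormType.alternating.formDim (d + 1) k ≤ k * m)
    (corank_two : ¬ (d + 1 + 2 = k + m ∧ Even (k + m))) (seven : ¬ (d + 1 = 3 ∧ k + m = 7)) :
    HasSeparatingArrays .alternating d k m := by
  by_cases hkm : k < m + (d + 1)
  · exact hasSeparatingArrays_alternating_of_lt hkm h
  obtain ⟨j, rfl⟩ : ∃ j, k = d + j + 1 := ⟨k - (d + 1), by lia⟩
  have choose_le := choose_le_of_formDim_alternating_le h
  have m_pos : 0 < m := by
    have := (Nat.choose_pos (Nat.le_add_right d j)).trans_le choose_le
    exact Nat.pos_of_mul_pos_left this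
  rcases Nat.lt_or_ge j 2 with hj | hj
  · obtain rfl : j = 1 := by lia
    obtain rfl : m = 1 := by lia
    exact hasSeparatingArrays_of_even (by_contra fun hd =>
      corank_two ⟨rfl, (Nat.not_even_iff_odd.mp hd).add_odd (by decide : Odd 3)⟩)
  · by_cases hne : d = 2 ∧ j = 2
    · obtain ⟨rfl, rfl⟩ := hne
      have : (2 + 2).choose 2 = 6 := rfl
      lia
    · have := Nat.lt_of_mul_lt_mul_left ((succ_mul_lt_choose hd hj hne).trans_le choose_le)
      lia

end Separating

section Cases

variable {V : Type*} [AddCommGroup V] [Module ℂ V] [FiniteDimensional ℂ V] {n d k : ℕ}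

theorem exists_not_hasIsotropicRows_of_not_le (ε : FormType) (hk : 1 ≤ k)
    (h : ¬ (ε.formDim d k : ℚ) / k + k ≤ n) :
    ∃ t ∈ symArray ℂ ε d (Fin n), ¬ HasIsotropicRows t k := by
  rw [div_add_le_iff hk] at h
  by_cases hkn : k ≤ n
  · refine exists_not_hasIsotropicRows ε ?_
    rw [Fintype.card_fin]
    exact not_le.mp fun le => h ⟨hkn, le⟩
  · exact ⟨0, Submodule.zero_mem _, fun hk => hkn (hk.le_card.trans_eq (Fintype.card_fin n))⟩

theorem symForm_hasIsotropicSubspace_iff (hn : Module.finrank ℂ V = n) (hd : 1 ≤ d) (hk : 1 ≤ k)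
    (hd2 : d ≠ 2) :
    HoldsGenerically fun w : SymForm d V =>
      (HasIsotropicSubspace (w : MultilinearMap ℂ (fun _ : Fin d => V) ℂ) k ↔
        (((d + k - 1).choose d : ℕ) : ℚ) / k + k ≤ n) := by
  refine SymForm.holdsGenerically_hasIsotropicSubspace_iff hn (fun h t ht => ?_)
    (exists_not_hasIsotropicRows_of_not_le .symmetric hk)
  obtain ⟨hkn, h⟩ := (div_add_le_iff hk).mp h
  obtain ⟨d, rfl⟩ := Nat.exists_eq_add_of_le' hd
  refine HasSeparatingArrays.hasIsotropicRows_fin hkn ?_ ht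
  rcases Nat.eq_zero_or_pos d with rfl | hd
  · refine hasSeparatingArrays_zero _ (Nat.le_of_mul_le_mul_left (c := k) ?_ hk)
    rw [Nat.choose_one_right, zero_add, Nat.add_sub_cancel_left] at h
    rwa [mul_one]
  · exact hasSeparatingArrays_symmetric (by lia) hk h

theorem symForm_two_hasIsotropicSubspace_iff (hn : Module.finrank ℂ V = n) :
    HoldsGenerically fun w : SymForm 2 V =>
      (HasIsotropicSubspace (w : MultilinearMap ℂ (fun _ : Fin 2 => V) ℂ) k ↔ 2 * k ≤ n) :=
  SymForm.holdsGenerically_hasIsotropicSubspace_iff hn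
    (fun h _ => HasSeparatingArrays.hasIsotropicRows_fin (by lia)
      (hasSeparatingArrays_symmetric_two (by lia)))
    fun h => exists_symmetric_not_hasIsotropicRows (not_le.mp h)

theorem alternatingMap_hasIsotropicSubspace_iff (hn : Module.finrank ℂ V = n) (hd : 1 ≤ d)
    (hk : 1 ≤ k) (hd2 : d ≠ 2) (corank_two : ¬ (d + 2 = n ∧ Even n)) (seven : ¬ (d = 3 ∧ n = 7)) :
    HoldsGenerically fun w : V [⋀^Fin d]→ₗ[ℂ] ℂ =>
      (HasIsotropicSubspace w.toMultilinearMap k ↔ ((k.choose d : ℕ) : ℚ) / k + k ≤ n) := by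
  refine alternatingMap_holdsGenerically_hasIsotropicSubspace_iff hn (fun h t ht => ?_)
    (exists_not_hasIsotropicRows_of_not_le .alternating hk)
  obtain ⟨hkn, h⟩ := (div_add_le_iff hk).mp h
  obtain ⟨d, rfl⟩ := Nat.exists_eq_add_of_le' hd
  refine HasSeparatingArrays.hasIsotropicRows_fin hkn ?_ ht
  rcases Nat.eq_zero_or_pos d with rfl | hd
  · refine hasSeparatingArrays_zero _ (Nat.le_of_mul_le_mul_left (c := k) ?_ hk)
    rw [Nat.choose_one_right] at h
    rwa [mul_one]
  · refine hasSeparatingArrays_alternating (by lia) h ?_ ?_ <;> rwa [Nat.add_sub_cancel' hkn]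

theorem alternatingMap_two_hasIsotropicSubspace_iff (hn : Module.finrank ℂ V = n) :
    HoldsGenerically fun w : V [⋀^Fin 2]→ₗ[ℂ] ℂ =>
      (HasIsotropicSubspace w.toMultilinearMap k ↔ 2 * k ≤ n + n % 2) :=
  alternatingMap_holdsGenerically_hasIsotropicSubspace_iff hn
    (fun h _ => HasSeparatingArrays.hasIsotropicRows_fin (by lia)
      (hasSeparatingArrays_alternating_two (by lia)))
    fun h => exists_alternating_not_hasIsotropicRows (not_le.mp h)

theorem alternatingMap_corank_two_hasIsotropicSubspace_iff (hn : Module.finrank ℂ V = d + 2)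
    (hd : 1 ≤ d) (even : Even d) :
    HoldsGenerically fun w : V [⋀^Fin d]→ₗ[ℂ] ℂ =>
      (HasIsotropicSubspace w.toMultilinearMap k ↔ k ≤ d) := by
  refine alternatingMap_holdsGenerically_hasIsotropicSubspace_iff hn (fun h t ht => ?_) fun h => ?_
  · obtain ⟨d, rfl⟩ := Nat.exists_eq_add_of_le' hd
    refine HasSeparatingArrays.hasIsotropicRows_fin (by lia)
      (hasSeparatingArrays_alternating_of_choose_le fun s hds hsk => ?_) ht
    obtain rfl : s = d := by lia
    obtain rfl : k = s + 1 := by lia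
    rw [Nat.choose_self]
    lia
  · obtain ⟨t, ht, not_rows⟩ := exists_not_hasIsotropicRows_corank_two even
    exact ⟨t, ht, fun rows => not_rows (rows.mono (by lia))⟩

theorem alternatingMap_three_hasIsotropicSubspace_iff (hn : Module.finrank ℂ V = 7) :
    HoldsGenerically fun w : V [⋀^Fin 3]→ₗ[ℂ] ℂ =>
      (HasIsotropicSubspace w.toMultilinearMap k ↔ k ≤ 4) := by
  refine alternatingMap_holdsGenerically_hasIsotropicSubspace_iff hn (fun h t ht => ?_) fun h => ?_
  · refine HasSeparatingArrays.hasIsotropicRows_fin (by lia)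
      (hasSeparatingArrays_alternating_of_choose_le fun s hs hsk => ?_) ht
    interval_cases k <;> interval_cases s <;> decide
  · obtain ⟨t, ht, not_rows⟩ := exists_not_hasIsotropicRows_seven
    exact ⟨t, ht, fun rows => not_rows (rows.mono (by lia))⟩

end Cases

theorem theorem4p14 (V : Type*) [AddCommGroup V] [Module ℂ V] [FiniteDimensional ℂ V]
    (n d k : ℕ) (hn : Module.finrank ℂ V = n) (hd : 1 ≤ d) (hk : 1 ≤ k) :
    -- symmetric forms, general case
    (d ≠ 2 → HoldsGenerically fun w : SymForm d V =>
      (HasIsotropicSubspace (w : MultilinearMap ℂ (fun _ : Fin d => V) ℂ) k ↔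
        (((d + k - 1).choose d : ℕ) : ℚ) / (k : ℚ) + (k : ℚ) ≤ (n : ℚ))) ∧
    -- symmetric forms of degree two
    (d = 2 → HoldsGenerically fun w : SymForm d V =>
      (HasIsotropicSubspace (w : MultilinearMap ℂ (fun _ : Fin d => V) ℂ) k ↔ 2 * k ≤ n)) ∧
    -- skew-symmetric forms, general case
    (d ≠ 2 → ¬ (d + 2 = n ∧ Even n) → ¬ (d = 3 ∧ n = 7) →
      HoldsGenerically fun w : V [⋀^Fin d]→ₗ[ℂ] ℂ =>
        (HasIsotropicSubspace w.toMultilinearMap k ↔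
          ((k.choose d : ℕ) : ℚ) / (k : ℚ) + (k : ℚ) ≤ (n : ℚ))) ∧
    -- skew-symmetric forms of degree two, in even dimension
    (d = 2 → Even n → HoldsGenerically fun w : V [⋀^Fin d]→ₗ[ℂ] ℂ =>
      (HasIsotropicSubspace w.toMultilinearMap k ↔ 2 * k ≤ n)) ∧
    -- skew-symmetric forms of degree two, in odd dimension
    (d = 2 → Odd n → HoldsGenerically fun w : V [⋀^Fin d]→ₗ[ℂ] ℂ =>
      (HasIsotropicSubspace w.toMultilinearMap k ↔ 2 * k ≤ n + 1)) ∧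
    -- skew-symmetric forms of degree `n - 2`, in even dimension
    (d + 2 = n → Even n → HoldsGenerically fun w : V [⋀^Fin d]→ₗ[ℂ] ℂ =>
      (HasIsotropicSubspace w.toMultilinearMap k ↔ k ≤ n - 2)) ∧
    -- skew-symmetric forms of degree three in dimension seven
    (d = 3 → n = 7 → HoldsGenerically fun w : V [⋀^Fin d]→ₗ[ℂ] ℂ =>
      (HasIsotropicSubspace w.toMultilinearMap k ↔ k ≤ 4)) := by
  refine ⟨fun hd2 => symForm_hasIsotropicSubspace_iff hn hd hk hd2, ?_,
    fun hd2 => alternatingMap_hasIsotropicSubspace_iff hn hd hk hd2, ?_, ?_, ?_, ?_⟩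
  · rintro rfl
    exact symForm_two_hasIsotropicSubspace_iff hn
  · rintro rfl even
    simpa only [Nat.even_iff.mp even, add_zero] using alternatingMap_two_hasIsotropicSubspace_iff hn
  · rintro rfl odd
    simpa only [Nat.odd_iff.mp odd] using alternatingMap_two_hasIsotropicSubspace_iff hn
  · rintro rfl even
    exact alternatingMap_corank_two_hasIsotropicSubspace_iff hn hd (even.tsub even_two)
  · rintro rfl rfl
    exact alternatingMap_three_hasIsotropicSubspace_iff hn
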